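/- Let $\pi$ be a set of primes, and write $m\in\pi'$ for a positive integer $m$ all of whose prime divisors lie outside $\pi$. A group $H$ is $\pi$-local if the map $x\mapsto x^q$ is a bijection of $H$ for every prime $q\notin\pi$. A $\pi$-localization of a group $G$ is a homomorphism $\varphi:G\to G_\pi$ to a $\pi$-local group $G_\pi$ such that for every homomorphism $\theta:G\to H$ to a $\pi$-local group $H$ there is a unique homomorphism $\theta_\pi:G_\pi\to H$ with $\theta_\pi\varphi=\theta$. Let $\mathbb Z_\pi$ be the additive group of the rational numbers with denominator in $\pi'$. For $x\in G$ let $C_G(x)$ be the centralizer of $x$ and put $$D_G(x)=\{g\in G\mid C_G(x)\cap g^{-1}C_G(x)g\neq 1\}.$$ The class $\mathcal P_\pi$ consists of the groups $G$ such that (i) the map $x\mapsto x^m$ is injective on $G$ for every $m\in\pi'$; and (ii) if $x\in G$ has no $m$-th root in $G$ for some $m\in\pi'$, then $C_G(x)$ is torsion-free and either (a) $D_G(x)=C_G(x)$, or (b) $D_G(x)$ is a subgroup of $G$ in which $C_G(x)$ has index $2$, and $C_G(x)$ is isomorphic to a subgroup of $\mathbb Z_\pi$. **Theorem.** If $G\in\mathcal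 P_\pi$, then $G$ embeds in its $\pi$-localization: a $\pi$-localization $\varphi:G\to G_\pi$ exists, and for every $\pi$-localization of $G$ the homomorphism $\varphi$ is injective. -/

import Mathlib

universe u

/-- `m` is a positive integer all of whose prime divisors lie outside `π` (that is, `m ∈ π'`). -/
def IsPiPrimeNumber (π : Set Nat.Primes) (m : ℕ) : Prop :=
  0 < m ∧ ∀ p : Nat.Primes, (p : ℕ) ∣ m → p ∉ π

/-- `G` is `π`-local: for every prime `q ∉ π` the map `x ↦ x ^ q` is bijective. -/
def IsPiLocal (π : Set Nat.Primes) (G : Type u) [Group G] : Prop :=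
  ∀ q : Nat.Primes, q ∉ π → Function.Bijective (fun x : G => x ^ (q : ℕ))

/-- `φ : G → L` is a `π`-localization of `G`: the group `L` is `π`-local and every homomorphism
from `G` to a `π`-local group factors uniquely through `φ`. -/
structure IsPiLocalization (π : Set Nat.Primes) {G L : Type u} [Group G] [Group L]
    (φ : G →* L) : Prop where
  isPiLocal : IsPiLocal π L
  existsUnique_lift : ∀ (H : Type u) [Group H], IsPiLocal π H →
    ∀ θ : G →* H, ∃! θ' : L →* H, θ'.comp φ = θ

/-- `G` is a `U_π`-group: `x ↦ x ^ m` is injective for every `m ∈ π'`. -/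
def IsUPiGroup (π : Set Nat.Primes) (G : Type u) [Group G] : Prop :=
  ∀ m : ℕ, IsPiPrimeNumber π m → Function.Injective (fun x : G => x ^ m)

/-- The centralizer `C_G(x)` of an element. -/
def elemCentralizer {G : Type u} [Group G] (x : G) : Subgroup G :=
  Subgroup.centralizer {x}

/-- The conjugate `C ^ g = g⁻¹ C g` of a subgroup. -/
def conjSubgroup {G : Type u} [Group G] (C : Subgroup G) (g : G) : Subgroup G :=
  C.map (MulAut.conj g⁻¹).toMonoidHom

/-- The set `D_G(x)` of all `g` such that `C_G(x) ∩ C_G(x) ^ g ≠ 1`. -/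
def DSet {G : Type u} [Group G] (x : G) : Set G :=
  {g | elemCentralizer x ⊓ conjSubgroup (elemCentralizer x) g ≠ ⊥}

/-- The additive group `ℤ_π` of all rational numbers whose denominator lies in `π'`. -/
def ZPi (π : Set Nat.Primes) : AddSubgroup ℚ where
  carrier := {r | IsPiPrimeNumber π r.den}
  zero_mem' := ⟨Rat.den_pos 0, fun p hp _ => p.2.one_lt.ne' (Nat.dvd_one.mp hp)⟩
  add_mem' := fun {a b} ha hb => ⟨Rat.den_pos (a + b), fun p hp =>
    ((Nat.Prime.dvd_mul p.2).mp (hp.trans (Rat.add_den_dvd a b))).elim (ha.2 p) (hb.2 p)⟩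
  neg_mem' := fun {a} ha => by simpa using ha

/-- The class `𝒫_π`. The index in the last alternative is that of `C_G(x)` in the
subgroup whose underlying set is `D_G(x)`, and `C_G(x) ≤ ℤ_π` means that `C_G(x)` is isomorphic
to a subgroup of `ℤ_π`. -/
structure InClassPPi (π : Set Nat.Primes) (G : Type u) [Group G] : Prop where
  isUPiGroup : IsUPiGroup π G
  cond : ∀ x : G, (∃ m : ℕ, IsPiPrimeNumber π m ∧ ¬ ∃ y : G, y ^ m = x) →
    (∀ c ∈ elemCentralizer x, IsOfFinOrder c → c = 1) ∧
    (DSet x = (elemCentralizer x : Set G) ∨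
      ((∃ D : Subgroup G, (D : Set G) = DSet x ∧ (elemCentralizer x).relIndex D = 2) ∧
        ∃ i : elemCentralizer x →* Multiplicative (ZPi π), Function.Injective i))

/-! A localization always exists: take formal expressions in the elements of `G` built with
products, inverses and roots, and identify two of them when they agree in every `π`-local group.
Since an injective homomorphism to a `π`-local group factors through every localization, injectivity
amounts to embedding `G` in some `π`-local group (`InClassPPi.exists_embedding`).

Such a group is the union of a chain in `𝒫_π` in which each group contains the missing roots of its
predecessor, so everything rests on `InClassPPi.exists_root_extension`. In `G ∈ 𝒫_π` the
centralizers `C` of rootless elements behave almost malnormally: two of them with a common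
nontrivial element coincide, and the elements of `D = D_G(x)` outside `C` are involutions inverting
`C`. Localizing the centre of `C` gives a group `B ⊇ D` with unique roots (`exists_root_closure`).
One such `B` is amalgamated with `G` along `D` for each conjugacy class of these centralizers.

The amalgam acts on its Bass–Serre tree. Malnormality of `C` at the vertices of type `G`, and of the
extra involutions at those of type `B`, implies that only the identity fixes two points at distance
at least 3. Elements fixing a vertex are conjugate into `G` or some `B`, hence have roots. Any other
element translates an axis; its centralizer acts faithfully on the axis by translations and its
`D`-set is the stabilizer of the axis, so condition (ii) holds with `C` embedded in `ℤ` and index at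
most 2 (`IsAxis.cond`). Thus the amalgam is again in `𝒫_π`.

The amalgam is realized by permutations of a large set on which the factors play ping-pong
(`Amalgam.nonempty`). The ping-pong sets then show that the coset graph is a tree
(`IsShadow.isTreeDist`), so no normal forms are needed. -/

/-! ### Integer tree metrics -/

/-- `d` is the path metric of a tree on `V`, and `col` is a proper colouring of it by parity. -/
structure IsTreeDist {V : Type*} (d : V → V → ℕ) (col : V → ℕ) : Prop where
  eq_of_zero : ∀ x y, d x y = 0 → x = y
  self : ∀ x, d x x = 0
  comm : ∀ x y, d x y = d y x
  tri : ∀ x y z, d x z ≤ d x y + d y z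
  four : ∀ x y z w, d x y + d z w ≤ max (d x z + d y w) (d x w + d y z)
  between : ∀ x y k, k ≤ d x y → ∃ z, d x z = k ∧ d z y = d x y - k
  parity : ∀ x y, (d x y + col x + col y) % 2 = 0

/-- `G` acts on `V` by isometries that preserve the colouring. -/
structure IsTreeAction (G : Type*) [Group G] {V : Type*} [MulAction G V]
    (d : V → V → ℕ) (col : V → ℕ) : Prop extends IsTreeDist d col where
  isom : ∀ (g : G) x y, d (g • x) (g • y) = d x y
  col_smul : ∀ (g : G) x, col (g • x) = col x

/-- `ι` is an isometrically embedded line. -/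
def IsLine {V : Type*} (d : V → V → ℕ) (ι : ℤ → V) : Prop :=
  ∀ m n, d (ι m) (ι n) = (m - n).natAbs

namespace IsTreeDist

variable {V : Type*} {d : V → V → ℕ} {col : V → ℕ}

/-- The four-point inequality for the pairs `x, y` and `z, w` leaves no room for a positive `d z w`.
-/
theorem seg_unique (hd : IsTreeDist d col) {x y z w : V} (hz : d x z + d z y = d x y)
    (hw : d x w + d w y = d x y)
    (h : d x z = d x w) : z = w := by
  apply hd.eq_of_zero
  have h1 := hd.four x y z w
  have h2 := hd.comm y w
  have h3 := hd.comm y z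
  omega

/-- In a tree, being geodesic is a local property, provided that consecutive segments overlap in
positive length. -/
theorem concat (hd : IsTreeDist d col) {a b c e : V} (hab : d a c = d a b + d b c)
    (hbe : d b e = d b c + d c e)
    (hbc : 0 < d b c) : d a e = d a b + d b c + d c e := by
  have h1 := hd.four a c b e
  have h2 := hd.tri a c e
  have h3 := hd.comm c b
  omega

end IsTreeDist

theorem IsLine.injective {V : Type*} {d : V → V → ℕ} {col : V → ℕ} (hd : IsTreeDist d col)
    {ι : ℤ → V} (hι : IsLine d ι) : Function.Injective ι := by
  intro m n h
  have h1 := hι m n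
  rw [h, hd.self] at h1
  omega

namespace IsTreeAction

variable {G : Type*} [Group G] {V : Type*} [MulAction G V] {d : V → V → ℕ} {col : V → ℕ}

theorem fixed_of_between (ha : IsTreeAction G d col) {g : G} {x y z : V} (hx : g • x = x)
    (hy : g • y = y)
    (hz : d x z + d z y = d x y) : g • z = z := by
  have h1 : d x (g • z) = d x z := by
    conv_lhs => rw [← hx]
    exact ha.isom ..
  have h2 : d (g • z) y = d z y := by
    conv_lhs => rw [← hy]
    exact ha.isom ..
  exact ha.seg_unique (by omega) hz h1

/-- Displacements along the orbit of a point of minimal positive displacement add up. -/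
theorem dist_pow_smul (ha : IsTreeAction G d col) {g : G} {x : V}
    (hmin : ∀ y, d x (g • x) ≤ d y (g • y))
    (hpos : 0 < d x (g • x)) (n : ℕ) : d x (g ^ n • x) = n * d x (g • x) := by
  set l := d x (g • x) with hl
  -- Colours are preserved, so no edge is inverted and `l ≥ 2`.
  have hev : l % 2 = 0 := by
    have := ha.parity x (g • x)
    rw [ha.col_smul] at this
    omega
  have hstep : ∀ n : ℕ, d (g ^ n • x) (g ^ (n + 1) • x) = l := by
    intro n
    rw [pow_succ, mul_smul, ha.isom]
  -- If the segments from `x` to `g • x` and on to `g ^ 2 • x` backtracked, the neighbour `y` of `x`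
  -- on the first would have displacement at most `l - 2`.
  have htwo : d x (g ^ 2 • x) = 2 * l := by
    obtain ⟨y, hy1, hy2⟩ := ha.between x (g • x) 1 (by omega)
    rw [← hl] at hy2
    have e2 : g ^ 2 • x = g • g • x := by rw [pow_two, mul_smul]
    rw [e2]
    have h1 := ha.tri x (g • x) (g • g • x)
    have h2 : d (g • x) (g • g • x) = l := ha.isom ..
    by_contra hne
    have h3 : d (g • x) (g • y) = 1 := by rw [ha.isom, hy1]
    have h4 : d (g • y) (g • g • x) = l - 1 := by rw [ha.isom, hy2]
    have par := ha.parity x (g • g • x)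
    rw [ha.col_smul, ha.col_smul] at par
    -- the point `g • y` lies on the segment from `x` to `g • x`
    have h5 : d x (g • y) ≤ l - 1 := by
      have := ha.four x (g • y) (g • x) (g • g • x)
      have := ha.comm (g • y) (g • x)
      have := ha.parity x (g • y)
      have := ha.parity x y
      rw [ha.col_smul] at *
      omega
    have h6 : d y (g • y) ≤ l - 2 := by
      have := ha.four y (g • y) x (g • x)
      have := ha.comm y x
      have := ha.comm (g • y) x
      have := ha.comm (g • y) (g • x)
      omega
    have := hmin y
    omega
  have key : ∀ n : ℕ, d x (g ^ n • x) = n * l ∧ d x (g ^ (n + 1) • x) = (n + 1) * l := by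
    intro n
    induction n with
    | zero => simp [ha.self, hl]
    | succ n ih =>
      obtain ⟨i1, i2⟩ := ih
      refine ⟨by exact_mod_cast i2, ?_⟩
      have h1 := hstep n
      have h2 := hstep (n + 1)
      have h3 : d (g ^ n • x) (g ^ (n + 1 + 1) • x) = 2 * l := by
        rw [show n + 1 + 1 = n + 2 from rfl, pow_add, mul_smul, ha.isom, htwo]
      have := ha.concat (a := x) (b := g ^ n • x) (c := g ^ (n + 1) • x)
        (e := g ^ (n + 1 + 1) • x) (by rw [i1, i2, h1]; ring) (by omega) (by omega)
      rw [this, i1, h1, h2]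
      ring
  exact (key n).1

/-- An element without fixed points translates a line. -/
theorem exists_line (ha : IsTreeAction G d col) {g : G} (hg : ∀ x : V, g • x ≠ x) [Nonempty V] :
    ∃ (l : ℕ) (ι : ℤ → V), 0 < l ∧ IsLine d ι ∧ ∀ n, g • ι n = ι (n + l) := by
  obtain ⟨x, hx⟩ : ∃ x, ∀ y, d x (g • x) ≤ d y (g • y) :=
    ⟨Function.argmin (fun x => d x (g • x)),
      fun y => Function.argmin_le (fun x => d x (g • x)) y⟩
  have hpos : 0 < d x (g • x) := by
    by_contra h
    exact hg x (ha.eq_of_zero _ _ (by omega)).symm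
  have hpow := ha.dist_pow_smul hx hpos
  set l := d x (g • x) with hl
  have hz : ∀ a b : ℤ, d (g ^ a • x) (g ^ b • x) = (a - b).natAbs * l := by
    have hle : ∀ a b : ℤ, a ≤ b → d (g ^ a • x) (g ^ b • x) = (a - b).natAbs * l := by
      intro a b hab
      obtain ⟨k, rfl⟩ := Int.le.dest hab
      rw [zpow_add, mul_smul, ha.isom, zpow_natCast, hpow]
      congr 1
      omega
    intro a b
    rcases le_total a b with hab | hab
    · exact hle a b hab
    · rw [ha.comm, hle b a hab]
      congr 1
      omega
  -- The point at signed distance `n` from `x` along the orbit. It is chosen between `g ^ (-N) • x`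
  -- and `g ^ N • x` with `N = |n|`; its distances to all farther orbit points are recorded because
  -- they determine it.
  have hpt : ∀ n : ℤ, ∃ p, ∀ M : ℕ, n.natAbs ≤ M →
      (d (g ^ (-(M : ℤ)) • x) p : ℤ) = M * l + n ∧ (d p (g ^ (M : ℤ) • x) : ℤ) = M * l - n := by
    intro n
    have hN : (n.natAbs : ℤ) ≤ n.natAbs * l := by nlinarith
    set N := n.natAbs with hNdef
    have hseg := hz (-(N : ℤ)) N
    have hseg' : (d (g ^ (-(N : ℤ)) • x) (g ^ (N : ℤ) • x) : ℤ) = 2 * (N * l) := by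
      rw [hseg, show (-(N : ℤ) - N).natAbs = 2 * N by omega]
      push_cast
      ring
    obtain ⟨p, hp1, hp2⟩ := ha.between (g ^ (-(N : ℤ)) • x) (g ^ (N : ℤ) • x)
      ((N : ℤ) * l + n).toNat (by omega)
    refine ⟨p, fun M hM => ?_⟩
    have e1 : (d (g ^ (-(M : ℤ)) • x) (g ^ (-(N : ℤ)) • x) : ℤ) = M * l - N * l := by
      rw [hz, show (-(M : ℤ) - -(N : ℤ)).natAbs = M - N by omega]
      push_cast [hM]
      ring
    have e2 : (d (g ^ (N : ℤ) • x) (g ^ (M : ℤ) • x) : ℤ) = M * l - N * l := by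
      rw [hz, show ((N : ℤ) - M).natAbs = M - N by omega]
      push_cast [hM]
      ring
    have e3 : (d (g ^ (-(M : ℤ)) • x) (g ^ (M : ℤ) • x) : ℤ) = 2 * (M * l) := by
      rw [hz, show (-(M : ℤ) - M).natAbs = 2 * M by omega]
      push_cast
      ring
    have t1 := ha.tri (g ^ (-(M : ℤ)) • x) (g ^ (-(N : ℤ)) • x) p
    have t2 := ha.tri p (g ^ (N : ℤ) • x) (g ^ (M : ℤ) • x)
    have t3 := ha.tri (g ^ (-(M : ℤ)) • x) p (g ^ (M : ℤ) • x)
    generalize (M : ℤ) * l = Ml at *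
    generalize (N : ℤ) * l = Nl at *
    omega
  choose ι hι using hpt
  refine ⟨l, ι, hpos, ?_, ?_⟩
  · intro m n
    obtain ⟨m1, m2⟩ := hι m (max m.natAbs n.natAbs) (le_max_left _ _)
    obtain ⟨n1, n2⟩ := hι n (max m.natAbs n.natAbs) (le_max_right _ _)
    have h3 : (d (g ^ (-((max m.natAbs n.natAbs : ℕ) : ℤ)) • x)
        (g ^ ((max m.natAbs n.natAbs : ℕ) : ℤ) • x) : ℤ)
        = 2 * ((max m.natAbs n.natAbs : ℕ) * l) := by
      rw [hz, show ∀ M : ℕ, (-(M : ℤ) - M).natAbs = 2 * M by omega]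
      push_cast
      ring
    generalize g ^ (-((max m.natAbs n.natAbs : ℕ) : ℤ)) • x = a at *
    generalize g ^ ((max m.natAbs n.natAbs : ℕ) : ℤ) • x = b at *
    generalize ((max m.natAbs n.natAbs : ℕ) : ℤ) * l = Ml at *
    have := ha.four a b (ι m) (ι n)
    have := ha.comm b (ι n)
    have := ha.comm b (ι m)
    have := ha.tri a (ι m) (ι n)
    have := ha.tri a (ι n) (ι m)
    have := ha.comm (ι n) (ι m)
    omega
  · intro n
    obtain ⟨M, hM1, hM2⟩ : ∃ M : ℕ, n.natAbs + 1 ≤ M ∧ (n + l).natAbs ≤ M :=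
      ⟨_, le_max_left _ _, le_max_right _ _⟩
    obtain ⟨k, rfl⟩ : ∃ k, M = k + 1 := ⟨M - 1, by omega⟩
    obtain ⟨a1, a2⟩ := hι (n + l) (k + 1) hM2
    obtain ⟨b1, -⟩ := hι n (k + 2) (by omega)
    obtain ⟨-, c2⟩ := hι n k (by omega)
    have e1 : d (g ^ (-((k + 1 : ℕ) : ℤ)) • x) (g • ι n)
        = d (g ^ (-((k + 2 : ℕ) : ℤ)) • x) (ι n) := by
      rw [← ha.isom g (g ^ (-((k + 2 : ℕ) : ℤ)) • x), smul_smul, ← zpow_one_add]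
      congr 3
    have e2 : d (g • ι n) (g ^ ((k + 1 : ℕ) : ℤ) • x) = d (ι n) (g ^ (k : ℤ) • x) := by
      rw [← ha.isom g (ι n), smul_smul, ← zpow_one_add]
      congr 3
      push_cast
      ring
    have e3 : (d (g ^ (-((k + 1 : ℕ) : ℤ)) • x) (g ^ ((k + 1 : ℕ) : ℤ) • x) : ℤ)
        = 2 * ((k + 1 : ℕ) * l) := by
      rw [hz, show ∀ M : ℕ, (-(M : ℤ) - M).natAbs = 2 * M by omega]
      push_cast
      ring
    have f1 : ((k + 2 : ℕ) : ℤ) * l = (k + 1 : ℕ) * l + l := by push_cast; ring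
    have f2 : ((k + 1 : ℕ) : ℤ) * l = (k : ℤ) * l + l := by push_cast; ring
    refine ha.seg_unique (x := g ^ (-((k + 1 : ℕ) : ℤ)) • x) (y := g ^ ((k + 1 : ℕ) : ℤ) • x)
      ?_ ?_ ?_ <;> omega

/-- The line translated by `g` is the set of points of minimal displacement. -/
theorem mem_line_of_dist (ha : IsTreeAction G d col) {g : G} {l : ℕ} {ι : ℤ → V}
    (hl : 0 < l) (hι : IsLine d ι) (hg : ∀ n, g • ι n = ι (n + l))
    {q : V} (hq : d q (g • q) ≤ l) : q ∈ Set.range ι := by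
  obtain ⟨j, hj⟩ : ∃ j, ∀ n, d q (ι j) ≤ d q (ι n) :=
    ⟨Function.argmin (fun n => d q (ι n)), fun n => Function.argmin_le (fun n => d q (ι n)) n⟩
  -- By parity, so distances from `q` increase strictly right away from the nearest point `ι j`.
  have hadj : ∀ n, d q (ι n) ≠ d q (ι (n + 1)) := by
    intro n
    have h1 := ha.parity q (ι n)
    have h2 := ha.parity q (ι (n + 1))
    have h3 := ha.parity (ι n) (ι (n + 1))
    have h4 := hι n (n + 1)
    omega
  have hr : d q (ι (j + l)) ≥ d q (ι j) + l := by
    have h1 := ha.four q (ι (j + 1)) (ι j) (ι (j + l))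
    have h2 := hι j (j + 1)
    have h3 := hι j (j + l)
    have h4 := hι (j + 1) (j + l)
    have h5 := hj (j + 1)
    have h6 := hadj j
    have h7 := hι (j + 1) j
    omega
  have hr' : d q (ι (j - l)) ≥ d q (ι j) + l := by
    have h1 := ha.four q (ι (j - 1)) (ι j) (ι (j - l))
    have h2 := hι (j - 1) j
    have h3 := hι j (j - l)
    have h4 := hι (j - 1) (j - l)
    have h5 := hj (j - 1)
    have h6 := hadj (j - 1)
    rw [sub_add_cancel] at h6
    omega
  have e1 : d (g • q) (ι j) = d q (ι (j - l)) := by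
    rw [← ha.isom g q, hg, sub_add_cancel]
  have e2 : d (g • q) (ι (j + l)) = d q (ι j) := by
    rw [← ha.isom g q, hg]
  -- This gives `d q (g • q) ≥ l + 2 * d q (ι j)`, so `q` is `ι j`.
  have h1 := ha.four q (ι (j + l)) (g • q) (ι j)
  have h2 := ha.comm (ι (j + l)) (g • q)
  have h3 := hι (j + l) j
  exact ⟨j, (ha.eq_of_zero _ _ (by omega)).symm⟩

/-- An isometry that maps a line into itself acts on it as a translation or a reflection. -/
theorem translation_or_reflection (ha : IsTreeAction G d col) {h : G} {ι : ℤ → V}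
    (hι : IsLine d ι)
    (hh : ∀ n, h • ι n ∈ Set.range ι) :
    ∃ c : ℤ, (∀ n, h • ι n = ι (n + c)) ∨ (∀ n, h • ι n = ι (c - n)) := by
  choose f hf using hh
  have hiso : ∀ m n, (f m - f n).natAbs = (m - n).natAbs := by
    intro m n
    rw [← hι, ← hι, hf, hf, ha.isom]
  refine ⟨f 0, ?_⟩
  have h1 := hiso 1 0
  rcases (by omega : f 1 = f 0 + 1 ∨ f 1 = f 0 - 1) with h | h
  · left
    intro n
    rw [← hf]
    congr 1
    have := hiso n 0
    have := hiso n 1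
    omega
  · right
    intro n
    rw [← hf]
    congr 1
    have := hiso n 0
    have := hiso n 1
    omega

end IsTreeAction

/-! ### Centralizers and the sets `D_G(x)` -/

theorem mem_elemCentralizer {G : Type u} [Group G] {x c : G} :
    c ∈ elemCentralizer x ↔ c * x = x * c := by
  unfold elemCentralizer
  rw [Subgroup.mem_centralizer_singleton_iff]

theorem mem_conjSubgroup {G : Type u} [Group G] {C : Subgroup G} {g y : G} :
    y ∈ conjSubgroup C g ↔ g * y * g⁻¹ ∈ C := by
  unfold conjSubgroup
  rw [Subgroup.mem_map]
  constructor
  · rintro ⟨c, hc, rfl⟩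
    simpa [mul_assoc] using hc
  · intro h
    exact ⟨_, h, by simp [mul_assoc]⟩

theorem mem_DSet {G : Type u} [Group G] {x g : G} :
    g ∈ DSet x ↔ ∃ c, c ≠ 1 ∧ c ∈ elemCentralizer x ∧ g * c * g⁻¹ ∈ elemCentralizer x := by
  unfold DSet
  rw [Set.mem_ofPred_eq, Ne, Subgroup.eq_bot_iff_forall]
  push Not
  constructor
  · rintro ⟨c, hc, h1⟩
    exact ⟨c, h1, hc.1, mem_conjSubgroup.1 hc.2⟩
  · rintro ⟨c, h1, hc, h2⟩
    exact ⟨c, ⟨hc, mem_conjSubgroup.2 h2⟩, h1⟩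

/-! ### Hyperbolic elements of acylindrical actions -/

/-- The integers embed in `ℤ_π`. -/
def intToZPi (π : Set Nat.Primes) : Multiplicative ℤ →* Multiplicative (ZPi π) :=
  AddMonoidHom.toMultiplicative
    { toFun := fun n => ⟨(n : ℚ), by
        change IsPiPrimeNumber π (n : ℚ).den
        rw [Rat.den_intCast]
        exact ⟨one_pos, fun p hp _ => p.2.one_lt.ne' (Nat.dvd_one.mp hp)⟩⟩
      map_zero' := by ext; simp
      map_add' := fun a b => by ext; simp }

theorem intToZPi_injective (π : Set Nat.Primes) : Function.Injective (intToZPi π) := by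
  intro a b h
  have := congrArg (fun z : Multiplicative (ZPi π) => ((Multiplicative.toAdd z : ZPi π) : ℚ)) h
  simp only [intToZPi, AddMonoidHom.toMultiplicative_apply_apply, toAdd_ofAdd,
    AddMonoidHom.coe_mk, ZeroHom.coe_mk, Int.cast_inj] at this
  exact Multiplicative.toAdd.injective this

namespace IsTreeAction

variable {G : Type u} [Group G] {V : Type*} [MulAction G V] {d : V → V → ℕ} {col : V → ℕ}

/-- An element without fixed points whose axis `ι` it translates by `l`, for an action in which
only the identity fixes two points at distance at least `3`. -/
structure IsAxis (G : Type u) [Group G] {V : Type*} [MulAction G V] (d : V → V → ℕ)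
    (g : G) (l : ℕ) (ι : ℤ → V) : Prop where
  pos : 0 < l
  line : IsLine d ι
  smul : ∀ n, g • ι n = ι (n + l)
  acyl : ∀ (h : G) x y, 3 ≤ d x y → h • x = x → h • y = y → h = 1

theorem IsAxis.eq_of_smul {g : G} {l : ℕ} {ι : ℤ → V} (hg : IsAxis G d g l ι) {h k : G}
    (hk : ∀ n, h • ι n = k • ι n) : h = k := by
  have : k⁻¹ * h = 1 := by
    refine hg.acyl _ (ι 0) (ι 3) (by rw [hg.line]; decide) ?_ ?_ <;>
    rw [mul_smul, hk, inv_smul_smul]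
  exact (inv_mul_eq_one.1 this).symm

/-- An element commuting with `g` preserves its displacements, hence its axis, and cannot reflect it
since that reverses the translation. Conversely, translations commute on the axis, where the action
is faithful. -/
theorem IsAxis.mem_centralizer_iff (ha : IsTreeAction G d col) {g : G} {l : ℕ} {ι : ℤ → V}
    (hg : IsAxis G d g l ι) {h : G} :
    h ∈ elemCentralizer g ↔ ∃ c : ℤ, ∀ n, h • ι n = ι (n + c) := by
  rw [mem_elemCentralizer]
  constructor
  · intro hc
    obtain ⟨c, h1 | h1⟩ := ha.translation_or_reflection hg.line (h := h) (fun n => by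
      apply ha.mem_line_of_dist hg.pos hg.line hg.smul
      rw [← mul_smul, ← hc, mul_smul, ha.isom, hg.smul, hg.line]
      omega)
    · exact ⟨c, h1⟩
    · exfalso
      have e : (h * g) • ι 0 = (g * h) • ι 0 := by rw [hc]
      rw [mul_smul, mul_smul, hg.smul, h1, h1, hg.smul] at e
      have := hg.line.injective ha.toIsTreeDist e
      have := hg.pos
      omega
  · rintro ⟨c, hc⟩
    apply hg.eq_of_smul
    intro n
    rw [mul_smul, mul_smul, hg.smul, hc, hc, hg.smul]
    congr 1
    ring

/-- The centralizer of an element with an axis embeds in `ℤ`. -/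
theorem IsAxis.exists_hom (ha : IsTreeAction G d col) {g : G} {l : ℕ} {ι : ℤ → V}
    (hg : IsAxis G d g l ι) :
    ∃ τ : elemCentralizer g →* Multiplicative ℤ, Function.Injective τ := by
  have h : ∀ h : elemCentralizer g, ∃ c : ℤ, ∀ n, (h : G) • ι n = ι (n + c) :=
    fun h => (hg.mem_centralizer_iff ha).1 h.2
  choose f hf using h
  refine ⟨MonoidHom.mk' (fun h => Multiplicative.ofAdd (f h)) ?_, ?_⟩
  · intro a b
    rw [← ofAdd_add]
    congr 1
    apply add_left_cancel (a := (0 : ℤ))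
    apply hg.line.injective ha.toIsTreeDist
    rw [← hf, Subgroup.coe_mul, mul_smul, hf, hf]
    congr 1
    ring
  · intro a b hab
    have hab : f a = f b := Multiplicative.ofAdd.injective hab
    ext
    apply hg.eq_of_smul
    intro n
    rw [hf, hf, hab]

/-- If `c ≠ 1` and `h * c * h⁻¹` both centralize `g`, both translate the axis of `g`. That axis is
then also the axis of `c`, and `h` maps the axis of `c` to that of its conjugate, so `h` preserves
the line. -/
theorem IsAxis.mem_DSet_iff (ha : IsTreeAction G d col) {g : G} {l : ℕ} {ι : ℤ → V}
    (hg : IsAxis G d g l ι) {h : G} :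
    h ∈ DSet g ↔ ∃ c : ℤ, (∀ n, h • ι n = ι (n + c)) ∨ (∀ n, h • ι n = ι (c - n)) := by
  have hg1 : g ≠ 1 := by
    rintro rfl
    have := hg.smul 0
    rw [one_smul] at this
    have := hg.line.injective ha.toIsTreeDist this
    have := hg.pos
    omega
  rw [mem_DSet]
  constructor
  · rintro ⟨c, hc1, hc, hc'⟩
    obtain ⟨t, ht⟩ := (hg.mem_centralizer_iff ha).1 hc
    obtain ⟨t', ht'⟩ := (hg.mem_centralizer_iff ha).1 hc'
    have key : ∀ (c : G) (t t' : ℤ), 0 < t → (∀ n, c • ι n = ι (n + t)) →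
        (∀ n, (h * c * h⁻¹) • ι n = ι (n + t')) → ∀ n, h⁻¹ • ι n ∈ Set.range ι := by
      intro c t t' hpos ht ht'
      have hl : ∀ {k : ℤ}, 0 < k → ((k.toNat : ℕ) : ℤ) = k := fun h => by omega
      -- the displacement of `c` at a point of the translate of the line is constant
      have hd : ∀ n, d (h⁻¹ • ι n) (c • h⁻¹ • ι n) = t'.natAbs := by
        intro n
        rw [← ha.isom h, smul_inv_smul, smul_smul, smul_smul, ht', hg.line]
        omega
      have hle : t'.natAbs ≤ t.natAbs := by
        by_contra hlt
        -- compare displacements of large powers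
        have hpow : ∀ k : ℕ, ∀ n, (c ^ k) • ι n = ι (n + k * t) := by
          intro k
          induction k with
          | zero => simp
          | succ k ih =>
            intro n
            rw [pow_succ, mul_smul, ht, ih]
            congr 1
            push_cast
            ring
        have hpow' : ∀ k : ℕ, ∀ n, ((h * c * h⁻¹) ^ k) • ι n = ι (n + k * t') := by
          intro k
          induction k with
          | zero => simp
          | succ k ih =>
            intro n
            rw [pow_succ, mul_smul, ht', ih]
            congr 1
            push_cast
            ring
        -- The displacements of a power of `c` at `h⁻¹ • ι 0` and at `ι 0` differ by at most `2 *
        -- r`, but for the exponent `2 * r + 1` they would differ by at least `2 * r + 1`.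
        set r := d (h⁻¹ • ι 0) (ι 0) with hr
        have h1 := ha.tri (h⁻¹ • ι 0) (ι 0) (c ^ (2 * r + 1) • h⁻¹ • ι 0)
        have h2 := ha.tri (ι 0) (c ^ (2 * r + 1) • ι 0) (c ^ (2 * r + 1) • h⁻¹ • ι 0)
        have h3 : d (h⁻¹ • ι 0) (c ^ (2 * r + 1) • h⁻¹ • ι 0)
            = (2 * r + 1) * t'.natAbs := by
          rw [← ha.isom h, smul_inv_smul, smul_smul, smul_smul, ← conj_pow, hpow', hg.line,
            zero_add, zero_sub, Int.natAbs_neg, Int.natAbs_mul, Int.natAbs_natCast]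
        have h4 : d (ι 0) (c ^ (2 * r + 1) • ι 0) = (2 * r + 1) * t.natAbs := by
          rw [hpow, hg.line, zero_add, zero_sub, Int.natAbs_neg, Int.natAbs_mul,
            Int.natAbs_natCast]
        have h5 : d (c ^ (2 * r + 1) • ι 0) (c ^ (2 * r + 1) • h⁻¹ • ι 0) = r := by
          rw [ha.isom, ha.comm]
        nlinarith
      intro n
      apply ha.mem_line_of_dist (l := t.toNat) (g := c) (by omega) hg.line
        (by intro n; rw [ht, hl hpos])
      rw [hd]
      omega
    have hne : t ≠ 0 := by
      rintro rfl
      apply hc1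
      apply hg.eq_of_smul
      intro n
      rw [ht, one_smul, add_zero]
    have hinv : ∀ {c : G} {t : ℤ}, (∀ n, c • ι n = ι (n + t)) →
        ∀ n, c⁻¹ • ι n = ι (n + -t) := by
      intro c t ht n
      rw [inv_smul_eq_iff, ht]
      congr 1
      ring
    have hmem : ∀ n, h⁻¹ • ι n ∈ Set.range ι := by
      rcases lt_or_gt_of_ne hne with hlt | hgt
      · refine key c⁻¹ (-t) (-t') (by omega) (hinv ht) ?_
        rw [← conj_inv]
        exact hinv ht'
      · exact key c t t' hgt ht ht'
    obtain ⟨k, hk | hk⟩ := ha.translation_or_reflection hg.line hmem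
    · refine ⟨-k, Or.inl fun n => ?_⟩
      have := hinv hk n
      rwa [inv_inv] at this
    · refine ⟨k, Or.inr fun n => ?_⟩
      rw [← inv_inv h, inv_smul_eq_iff, hk]
      congr 1
      ring
  · rintro ⟨c, hc | hc⟩
    · have : h ∈ elemCentralizer g := (hg.mem_centralizer_iff ha).2 ⟨c, hc⟩
      refine ⟨g, hg1, mem_elemCentralizer.2 rfl, ?_⟩
      rw [mem_elemCentralizer.1 this, mul_inv_cancel_right]
      exact mem_elemCentralizer.2 rfl
    · refine ⟨g, hg1, mem_elemCentralizer.2 rfl, ?_⟩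
      rw [hg.mem_centralizer_iff ha]
      refine ⟨-l, fun n => ?_⟩
      have hinv : h⁻¹ • ι n = ι (c - n) := by
        rw [inv_smul_eq_iff, hc]
        congr 1
        ring
      rw [mul_smul, mul_smul, hinv, hg.smul, hc]
      congr 1
      ring

/-- Elements with an axis satisfy the second condition of `𝒫_π`. -/
theorem IsAxis.cond (ha : IsTreeAction G d col) {g : G} {l : ℕ} {ι : ℤ → V}
    (hg : IsAxis G d g l ι) (π : Set Nat.Primes) :
    (∀ c ∈ elemCentralizer g, IsOfFinOrder c → c = 1) ∧
    (DSet g = (elemCentralizer g : Set G) ∨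
      ((∃ D : Subgroup G, (D : Set G) = DSet g ∧ (elemCentralizer g).relIndex D = 2) ∧
        ∃ i : elemCentralizer g →* Multiplicative (ZPi π), Function.Injective i)) := by
  obtain ⟨τ, hτ⟩ := hg.exists_hom ha
  refine ⟨?_, ?_⟩
  · intro c hc hfin
    obtain ⟨n, hn, hcn⟩ := isOfFinOrder_iff_pow_eq_one.1 hfin
    have h1 : (⟨c, hc⟩ : elemCentralizer g) ^ n = 1 := Subtype.ext hcn
    have h2 : τ ⟨c, hc⟩ = 1 := by
      have h := congrArg (fun z => Multiplicative.toAdd (τ z)) h1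
      simp only [map_pow, map_one, toAdd_pow, toAdd_one, nsmul_eq_mul] at h
      rcases mul_eq_zero.1 h with h | h
      · omega
      · exact Multiplicative.toAdd.injective h
    have h3 := hτ (h2.trans (map_one τ).symm)
    exact congrArg Subtype.val h3
  · by_cases hD : DSet g = (elemCentralizer g : Set G)
    · exact Or.inl hD
    right
    refine ⟨?_, (intToZPi π).comp τ, (intToZPi_injective π).comp hτ⟩
    -- The stabilizer of the axis; it contains a reflection here, and any two reflections differ by
    -- a translation.
    let D : Subgroup G :=
      { carrier := DSet g
        one_mem' := (hg.mem_DSet_iff ha).2 ⟨0, Or.inl fun n => by simp⟩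
        mul_mem' := by
          intro a b h1 h2
          obtain ⟨s, hs | hs⟩ := (hg.mem_DSet_iff ha).1 h1 <;>
          obtain ⟨t, ht | ht⟩ := (hg.mem_DSet_iff ha).1 h2 <;>
          refine (hg.mem_DSet_iff ha).2 ?_
          · exact ⟨t + s, Or.inl fun n => by rw [mul_smul, ht, hs]; congr 1; ring⟩
          · exact ⟨t + s, Or.inr fun n => by rw [mul_smul, ht, hs]; congr 1; ring⟩
          · exact ⟨s - t, Or.inr fun n => by rw [mul_smul, ht, hs]; congr 1; ring⟩
          · exact ⟨s - t, Or.inl fun n => by rw [mul_smul, ht, hs]; congr 1; ring⟩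
        inv_mem' := by
          intro a h1
          obtain ⟨s, hs | hs⟩ := (hg.mem_DSet_iff ha).1 h1 <;>
          refine (hg.mem_DSet_iff ha).2 ?_
          · exact ⟨-s, Or.inl fun n => by rw [inv_smul_eq_iff, hs]; congr 1; ring⟩
          · exact ⟨s, Or.inr fun n => by rw [inv_smul_eq_iff, hs]; congr 1; ring⟩ }
    have hCD : (elemCentralizer g : Set G) ⊆ DSet g := fun h hh =>
      (hg.mem_DSet_iff ha).2 <| ((hg.mem_centralizer_iff ha).1 hh).imp fun c hc => Or.inl hc
    obtain ⟨a, haD, haC⟩ : ∃ a ∈ DSet g, a ∉ elemCentralizer g := by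
      by_contra hcon
      push Not at hcon
      exact hD (Set.Subset.antisymm hcon hCD)
    refine ⟨D, rfl, ?_⟩
    have hrefl : ∀ b ∈ DSet g, b ∉ elemCentralizer g → ∃ c : ℤ, ∀ n, b • ι n = ι (c - n) := by
      intro b hb hbC
      obtain ⟨c, hc | hc⟩ := (hg.mem_DSet_iff ha).1 hb
      · exact absurd ((hg.mem_centralizer_iff ha).2 ⟨c, hc⟩) hbC
      · exact ⟨c, hc⟩
    obtain ⟨s, hs⟩ := hrefl a haD haC
    rw [Subgroup.relIndex, Subgroup.index_eq_two_iff]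
    refine ⟨⟨a, haD⟩, fun b => ?_⟩
    simp only [Subgroup.mem_subgroupOf, Subgroup.coe_mul]
    by_cases hb : (b : G) ∈ elemCentralizer g
    · refine Or.inr ⟨hb, fun h => haC ?_⟩
      exact (Subgroup.mul_mem_cancel_left _ hb).1 h
    · refine Or.inl ⟨?_, hb⟩
      obtain ⟨t, ht⟩ := hrefl b b.2 hb
      rw [hg.mem_centralizer_iff ha]
      exact ⟨t - s, fun n => by rw [mul_smul, hs, ht]; congr 1; ring⟩

end IsTreeAction

/-! ### Edge stabilizers, unique roots and the criterion for `𝒫_π` -/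

theorem IsPiPrimeNumber.two {π : Set Nat.Primes} {m : ℕ} (hm : IsPiPrimeNumber π m)
    (h2 : 2 ∣ m) : IsPiPrimeNumber π 2 := by
  refine ⟨by norm_num, fun p hp => hm.2 p ?_⟩
  exact hp.trans h2

theorem pow_eq_self_of_odd {G : Type*} [Group G] {w : G} (hw : w * w = 1) {m : ℕ}
    (hm : ¬ 2 ∣ m) : w ^ m = w := by
  obtain ⟨k, rfl⟩ : ∃ k, m = 2 * k + 1 := ⟨m / 2, by omega⟩
  rw [pow_succ, pow_mul, pow_two, hw, one_pow, one_mul]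

namespace IsTreeAction

variable {G : Type u} [Group G] {V : Type*} [MulAction G V] {d : V → V → ℕ} {col : V → ℕ}

/-- A nontrivial element fixing an edge `uv` either fixes no other edge at its end `u` of
colour `0`, or is an involution fixing no other edge at its end `v` of colour `1`. -/
def EdgeCond (G : Type u) [Group G] {V : Type*} [MulAction G V] (d : V → V → ℕ)
    (col : V → ℕ) : Prop :=
  ∀ (u v : V) (h : G), d u v = 1 → col u = 0 → h • u = u → h • v = v → h ≠ 1 →
    (∀ v', d u v' = 1 → h • v' = v' → v' = v) ∨
    (h * h = 1 ∧ ∀ u', d v u' = 1 → h • u' = u' → u' = u)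

/-- Fixed points at distance 3 or more yield three consecutive fixed edges `xp`, `pq`, `qr`. The
middle one has another fixed edge at each end, against both alternatives of `EdgeCond`. -/
theorem EdgeCond.acylindrical (ha : IsTreeAction G d col) (hcol : ∀ v, col v = 0 ∨ col v = 1)
    (hE : EdgeCond G d col) (h : G) (x y : V) (hxy : 3 ≤ d x y) (hx : h • x = x)
    (hy : h • y = y) : h = 1 := by
  by_contra hne
  obtain ⟨r, hr1, hr2⟩ := ha.between x y 3 hxy
  have hr : h • r = r := ha.fixed_of_between hx hy (by omega)
  obtain ⟨p, hp1, hp2⟩ := ha.between x r 1 (by omega)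
  have hp : h • p = p := ha.fixed_of_between hx hr (by omega)
  obtain ⟨q, hq1, hq2⟩ := ha.between p r 1 (by omega)
  have hq : h • q = q := ha.fixed_of_between hp hr (by omega)
  have hxq : x ≠ q := by
    rintro rfl
    omega
  have hpr : p ≠ r := by
    rintro rfl
    omega
  have c1 := ha.comm x p
  have c2 := ha.comm q p
  have par := ha.parity p q
  rcases hcol p with h0 | h0
  · rcases hE p q h hq1 h0 hp hq hne with h1 | ⟨-, h1⟩
    · exact hxq (h1 x (by omega) hx)
    · exact hpr (h1 r (by omega) hr).symm
  · have h0' : col q = 0 := by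
      rcases hcol q with h | h <;> omega
    rcases hE q p h (by omega) h0' hq hp hne with h1 | ⟨-, h1⟩
    · exact hpr (h1 r (by omega) hr).symm
    · exact hxq (h1 x (by omega) hx)

theorem exists_isAxis (ha : IsTreeAction G d col) [Nonempty V]
    (hcol : ∀ v, col v = 0 ∨ col v = 1) (hE : EdgeCond G d col) {g : G}
    (hg : ∀ x : V, g • x ≠ x) : ∃ l ι, IsAxis G d g l ι := by
  obtain ⟨l, ι, h1, h2, h3⟩ := ha.exists_line hg
  exact ⟨l, ι, h1, h2, h3, hE.acylindrical ha hcol⟩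

/-- Both roots lie in the centralizer of the common power, which has an axis too and so embeds in
`ℤ`. -/
theorem IsAxis.eq_of_pow_eq (ha : IsTreeAction G d col) {x y : G} {l : ℕ} {ι : ℤ → V}
    (hx : IsAxis G d x l ι) {m : ℕ} (hm : 0 < m) (h : x ^ m = y ^ m) : x = y := by
  have hw : IsAxis G d (x ^ m) (m * l) ι := by
    refine ⟨Nat.mul_pos hm hx.pos, hx.line, ?_, hx.acyl⟩
    clear h hm
    induction m with
    | zero => simp
    | succ k ih =>
      intro n
      rw [pow_succ, mul_smul, hx.smul, ih]
      congr 1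
      push_cast
      ring
  obtain ⟨τ, hτ⟩ := hw.exists_hom ha
  have hxm : x ∈ elemCentralizer (x ^ m) :=
    mem_elemCentralizer.2 (Commute.self_pow x m).eq
  have hym : y ∈ elemCentralizer (x ^ m) :=
    mem_elemCentralizer.2 (by rw [h]; exact (Commute.self_pow y m).eq)
  have h1 : (⟨x, hxm⟩ : elemCentralizer (x ^ m)) ^ m = ⟨y, hym⟩ ^ m := Subtype.ext h
  have h2 : τ ⟨x, hxm⟩ = τ ⟨y, hym⟩ := by
    have h := congrArg (fun z => Multiplicative.toAdd (τ z)) h1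
    simp only [map_pow, toAdd_pow, nsmul_eq_mul] at h
    exact Multiplicative.toAdd.injective (mul_left_cancel₀ (by exact_mod_cast hm.ne') h)
  exact congrArg Subtype.val (hτ h2)

variable {π : Set Nat.Primes}

/-- Elements with fixed points have at most one root of each order in `π'`. -/
theorem eq_of_pow_eq_of_fixed (ha : IsTreeAction G d col) (hcol : ∀ v, col v = 0 ∨ col v = 1)
    (hE : EdgeCond G d col)
    (hU : ∀ (v : V) (m : ℕ), IsPiPrimeNumber π m → ∀ x y : G, x • v = v → y • v = v →
      x ^ m = y ^ m → x = y)
    {m : ℕ} (hm : IsPiPrimeNumber π m) {x y : G} {p q : V} (hp : x • p = p) (hq : y • q = q)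
    (hxy : x ^ m = y ^ m) : x = y := by
  have hpow : ∀ {x : G} {p : V}, x • p = p → x ^ m • p = p := by
    intro x p hp
    exact (MulAction.stabilizer G p).pow_mem hp m
  by_cases hw : x ^ m = 1
  · have h1 : x = 1 := hU p m hm x 1 hp (one_smul _ _) (by rw [hw, one_pow])
    have h2 : y = 1 := hU q m hm y 1 hq (one_smul _ _) (by rw [← hxy, hw, one_pow])
    rw [h1, h2]
  -- Unique square roots would kill the involution if `m` were even. For odd `m` it is its own
  -- `m`-th power, so it equals its root `x`.
  have hinv : ∀ {x : G} {p : V}, x • p = p → x ^ m ≠ 1 → x ^ m * x ^ m = 1 → x ^ m = x := by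
    intro x p hp hw hww
    have hodd : ¬ 2 ∣ m := by
      intro h2
      exact hw (hU p 2 (hm.two h2) _ 1 (hpow hp) (one_smul _ _)
        (by rw [pow_two, hww, one_pow]))
    exact hU p m hm _ _ (hpow hp) hp (pow_eq_self_of_odd hww hodd)
  -- `x ^ m` fixes the edges from `u` to both `v` and `x • v`, so these coincide unless `x ^ m` is
  -- an involution, and then `x = x ^ m`.
  have hfix : ∀ {x : G} {u v : V}, d u v = 1 → col u = 0 → x • u = u → x ^ m • v = v →
      x ^ m ≠ 1 → x • v = v := by
    intro x u v huv hu hxu hxv hw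
    rcases hE u v (x ^ m) huv hu (hpow hxu) hxv hw with h1 | ⟨h1, -⟩
    · apply h1
      · conv_lhs => rw [← hxu]
        rw [ha.isom, huv]
      · rw [smul_smul, ← pow_succ, pow_succ', mul_smul, hxv]
    · have := hinv hxu hw h1
      rwa [this] at hxv
  have hwp := hpow hp
  have hwq : x ^ m • q = q := by rw [hxy]; exact hpow hq
  have hd : d p q ≤ 2 := by
    by_contra h
    exact hw (hE.acylindrical ha hcol _ p q (by omega) hwp hwq)
  have hw' : y ^ m ≠ 1 := hxy ▸ hw
  have par := ha.parity p q
  rcases (by omega : d p q = 0 ∨ d p q = 1 ∨ d p q = 2) with h | h | h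
  · obtain rfl := ha.eq_of_zero _ _ h
    exact hU p m hm x y hp hq hxy
  · rcases hcol p with h0 | h0
    · have := hfix h h0 hp hwq hw
      exact hU q m hm x y this hq hxy
    · have h0' : col q = 0 := by
        rcases hcol q with h | h <;> omega
      have := hfix (ha.comm p q ▸ h) h0' hq (hxy ▸ hwp) hw'
      exact hU p m hm x y hp this hxy
  · obtain ⟨r, hr1, hr2⟩ := ha.between p q 1 (by omega)
    have hwr : x ^ m • r = r := ha.fixed_of_between hwp hwq (by omega)
    have par' := ha.parity p r
    rcases hcol p with h0 | h0
    · have h1 := hfix hr1 h0 hp hwr hw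
      have h2 := hfix (u := q) (v := r) (by rw [ha.comm, hr2, h])
        (by rcases hcol q with h | h <;> omega) hq (hxy ▸ hwr) hw'
      exact hU r m hm x y h1 h2 hxy
    -- Here the common power fixes two edges at the vertex `r` of colour 0, so it is an involution
    -- and equals both of its roots.
    · have hr0 : col r = 0 := by rcases hcol r with h | h <;> omega
      rcases hE r p _ (by rw [ha.comm, hr1]) hr0 hwr hwp hw with h1 | ⟨h1, -⟩
      · have := h1 q (by omega) hwq
        rw [this, ha.self] at h
        omega
      · rw [← hinv hp hw h1, ← hinv hq hw' (hxy ▸ h1), hxy]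

/-- Criterion for membership in `𝒫_π` of a group acting on a tree. -/
theorem inClassPPi (ha : IsTreeAction G d col) [Nonempty V]
    (hcol : ∀ v, col v = 0 ∨ col v = 1) (hE : EdgeCond G d col)
    (hU : ∀ (v : V) (m : ℕ), IsPiPrimeNumber π m → ∀ x y : G, x • v = v → y • v = v →
      x ^ m = y ^ m → x = y)
    (hR : ∀ (v : V) (m : ℕ), IsPiPrimeNumber π m → ∀ x : G, x • v = v → ∃ y, y ^ m = x) :
    InClassPPi π G := by
  constructor
  · intro m hm x y hxy
    by_cases hx : ∃ p : V, x • p = p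
    · by_cases hy : ∃ q : V, y • q = q
      · obtain ⟨p, hp⟩ := hx
        obtain ⟨q, hq⟩ := hy
        exact ha.eq_of_pow_eq_of_fixed hcol hE hU hm hp hq hxy
      · push Not at hy
        obtain ⟨l, ι, h⟩ := ha.exists_isAxis hcol hE hy
        exact (h.eq_of_pow_eq ha hm.1 (Eq.symm hxy)).symm
    · push Not at hx
      obtain ⟨l, ι, h⟩ := ha.exists_isAxis hcol hE hx
      exact h.eq_of_pow_eq ha hm.1 hxy
  · rintro x ⟨m, hm, hroot⟩
    have hx : ∀ p : V, x • p ≠ p := fun p hp => hroot (hR p m hm x hp)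
    obtain ⟨l, ι, h⟩ := ha.exists_isAxis hcol hE hx
    exact h.cond ha π

end IsTreeAction

/-! ### Recognizing trees -/

section Graph

variable {V : Type*} {T : SimpleGraph V} {col : V → ℕ}

theorem dist_le_dist_add_one (hT : T.Connected) {u v : V} (h : T.Adj u v) (r : V) :
    T.dist u r ≤ T.dist v r + 1 := by
  have h1 := hT.dist_triangle (u := u) (v := v) (w := r)
  rw [SimpleGraph.dist_eq_one_iff_adj.2 h] at h1
  omega

theorem exists_adj_dist (hT : T.Connected) {v r : V} (h : v ≠ r) :
    ∃ u, T.Adj v u ∧ T.dist v r = T.dist u r + 1 := by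
  obtain ⟨p, hp⟩ := hT.exists_walk_length_eq_dist v r
  cases p with
  | nil => exact absurd rfl h
  | cons hadj q =>
    refine ⟨_, hadj, ?_⟩
    have h1 := SimpleGraph.dist_le q
    have h2 := dist_le_dist_add_one hT hadj r
    rw [SimpleGraph.Walk.length_cons] at hp
    omega

theorem dist_parity (hT : T.Connected) (hcol : ∀ u v, T.Adj u v → (col u + col v) % 2 = 1)
    (x y : V) : (T.dist x y + col x + col y) % 2 = 0 := by
  obtain ⟨p, hp⟩ := hT.exists_walk_length_eq_dist x y
  rw [← hp]
  clear hp
  induction p with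
  | nil => simp; omega
  | cons h q ih =>
    have := hcol _ _ h
    rw [SimpleGraph.Walk.length_cons]
    omega

/-- A geodesic and its continuation away from a point form a geodesic. -/
theorem dist_add_of_step (hT : T.Connected)
    (hcol : ∀ u v, T.Adj u v → (col u + col v) % 2 = 1)
    (hU : ∀ r v u u', T.Adj v u → T.Adj v u' → T.dist v r = T.dist u r + 1 →
      T.dist v r = T.dist u' r + 1 → u = u') (y z : V) :
    ∀ (n : ℕ) (x x' : V), T.dist x z = n → T.Adj x x' → T.dist x y = T.dist x' y + 1 →
      T.dist x' z = T.dist x z + 1 → T.dist y z = T.dist x y + T.dist x z := by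
  intro n
  induction n with
  | zero =>
    intro x x' hn _ _ _
    obtain rfl := hT.dist_eq_zero_iff.1 hn
    rw [T.dist_comm, SimpleGraph.dist_self, add_zero]
  | succ n ih =>
    intro x x' hn hadj hy hz
    obtain ⟨w, hw, hwz⟩ := exists_adj_dist hT (v := x) (r := z) (by rintro rfl; simp at hn)
    have hne : w ≠ x' := by
      rintro rfl
      omega
    have h1 := dist_le_dist_add_one hT hw y
    have h2 := dist_le_dist_add_one hT hw.symm y
    have p1 := dist_parity hT hcol x y
    have p2 := dist_parity hT hcol w y
    have p3 := hcol _ _ hw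
    have h3 : T.dist x y ≠ T.dist w y + 1 := fun h => hne (hU y x w x' hw hadj h hy)
    have := ih w x (by omega) hw.symm (by omega) (by omega)
    omega

/-- Move `x` one step towards `y`, to `x'`. For each of `z` and `w`, either `x'` is also closer to
it or `x` lies between it and `y`; in all four cases the inequality follows from that for `x'` or
from the triangle inequality. -/
theorem four_point (hT : T.Connected)
    (hcol : ∀ u v, T.Adj u v → (col u + col v) % 2 = 1)
    (hU : ∀ r v u u', T.Adj v u → T.Adj v u' → T.dist v r = T.dist u r + 1 →
      T.dist v r = T.dist u' r + 1 → u = u') (y z w : V) :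
    ∀ (n : ℕ) (x : V), T.dist x y = n → T.dist x y + T.dist z w ≤
      max (T.dist x z + T.dist y w) (T.dist x w + T.dist y z) := by
  intro n
  induction n with
  | zero =>
    intro x hn
    obtain rfl := hT.dist_eq_zero_iff.1 hn
    have h1 := hT.dist_triangle (u := z) (v := x) (w := w)
    rw [T.dist_comm (u := z) (v := x)] at h1
    omega
  | succ n ih =>
    intro x hn
    obtain ⟨x', hadj, hx'⟩ := exists_adj_dist hT (v := x) (r := y) (by rintro rfl; simp at hn)
    have key : ∀ z, T.dist x z = T.dist x' z + 1 ∨ T.dist y z = T.dist x y + T.dist x z := by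
      intro z
      have h1 := dist_le_dist_add_one hT hadj z
      have h2 := dist_le_dist_add_one hT hadj.symm z
      have p1 := dist_parity hT hcol x z
      have p2 := dist_parity hT hcol x' z
      have p3 := hcol _ _ hadj
      by_cases h : T.dist x z = T.dist x' z + 1
      · exact Or.inl h
      · exact Or.inr (dist_add_of_step hT hcol hU y z _ x x' rfl hadj hx' (by omega))
    have h1 := hT.dist_triangle (u := z) (v := x) (w := w)
    rw [T.dist_comm (u := z) (v := x)] at h1
    have h2 := ih x' (by omega)
    rcases key z with hz | hz <;> rcases key w with hw | hw <;> omega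

/-- Shadows: a system of subsets of a set `Y` attached to the oriented edges of a graph, from
which one recognizes that the graph is a tree. -/
structure IsShadow {Y : Type*} (T : SimpleGraph V) (col : V → ℕ) (Sh : V → V → Set Y) : Prop where
  compl : ∀ u v, T.Adj u v → Sh u v = (Sh v u)ᶜ
  disj : ∀ v u u', T.Adj v u → T.Adj v u' → u ≠ u' → Disjoint (Sh v u) (Sh v u')
  base : ∀ v, col v = 0 → ∃ o, ∀ u, T.Adj v u → o ∉ Sh v u

/-- The base point of `r` lies in the shadow of every edge directed towards `r`, by induction on the
distance; shadows of distinct edges leaving `v` are disjoint. -/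
theorem IsShadow.unique_of_col_zero {Y : Type*} {Sh : V → V → Set Y} (hSh : IsShadow T col Sh)
    (hT : T.Connected) {r v u u' : V} (hr : col r = 0) (hu : T.Adj v u) (hu' : T.Adj v u')
    (h : T.dist v r = T.dist u r + 1) (h' : T.dist v r = T.dist u' r + 1) : u = u' := by
  obtain ⟨o, ho⟩ := hSh.base r hr
  have key : ∀ (n : ℕ) (v u : V), T.dist u r = n → T.Adj v u → T.dist v r = T.dist u r + 1 →
      o ∈ Sh v u := by
    intro n
    induction n with
    | zero =>
      intro v u hn hadj _
      obtain rfl := hT.dist_eq_zero_iff.1 hn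
      rw [hSh.compl _ _ hadj]
      exact ho v hadj.symm
    | succ n ih =>
      intro v u hn hadj hv
      obtain ⟨w, hw, hwr⟩ := exists_adj_dist hT (v := u) (r := r) (by rintro rfl; simp at hn)
      have h1 := ih u w (by omega) hw hwr
      have hne : w ≠ v := by
        rintro rfl
        omega
      rw [hSh.compl _ _ hadj]
      exact fun h2 => Set.disjoint_left.1 (hSh.disj u w v hw hadj.symm hne) h1 h2
  by_contra hne
  exact Set.disjoint_left.1 (hSh.disj v u u' hu hu' hne) (key _ v u rfl hu h)
    (key _ v u' rfl hu' h')

/-- Vertices of colour 1 need not have base points, so the case of colour 1 is reduced to that of an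
adjacent vertex. -/
theorem IsShadow.unique {Y : Type*} {Sh : V → V → Set Y} (hSh : IsShadow T col Sh)
    (hT : T.Connected) (hcol : ∀ u v, T.Adj u v → (col u + col v) % 2 = 1)
    (hcol' : ∀ v, col v = 0 ∨ col v = 1) {r v u u' : V} (hu : T.Adj v u)
    (hu' : T.Adj v u') (h : T.dist v r = T.dist u r + 1) (h' : T.dist v r = T.dist u' r + 1) :
    u = u' := by
  rcases hcol' r with hr | hr
  · exact hSh.unique_of_col_zero hT hr hu hu' h h'
  by_contra hne
  have hur : u ≠ r := by
    rintro rfl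
    rw [SimpleGraph.dist_self] at h
    exact hne (hT.dist_eq_zero_iff.1 (by omega)).symm
  have hur' : u' ≠ r := by
    rintro rfl
    rw [SimpleGraph.dist_self] at h'
    exact hne (hT.dist_eq_zero_iff.1 (by omega))
  -- move the root to the neighbour `s` of `r` on a geodesic from `u` to `r`
  obtain ⟨s, hs, hsu⟩ := exists_adj_dist hT (v := r) (r := u) (Ne.symm hur)
  have hs0 : col s = 0 := by
    have := hcol _ _ hs
    rcases hcol' s with h | h <;> omega
  obtain ⟨w, hw, hwr⟩ := exists_adj_dist hT hur'
  have hwv : w ≠ v := by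
    rintro rfl
    omega
  have c1 := T.dist_comm (u := r) (v := u)
  have c2 := T.dist_comm (u := s) (v := u)
  have d1 : T.dist u s + 1 = T.dist u r := by omega
  have d2 : T.dist v s = T.dist u s + 1 := by
    have := dist_le_dist_add_one hT hu s
    have t := hT.dist_triangle (u := v) (v := s) (w := r)
    rw [SimpleGraph.dist_eq_one_iff_adj.2 hs.symm] at t
    omega
  have d3 : T.dist u' s = T.dist v s + 1 := by
    have h1 := dist_le_dist_add_one hT hu'.symm s
    have h2 := dist_le_dist_add_one hT hu' s
    have p1 := dist_parity hT hcol v s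
    have p2 := dist_parity hT hcol u' s
    have p3 := hcol _ _ hu'
    have h3 : T.dist v s ≠ T.dist u' s + 1 := fun h3 =>
      hne (hSh.unique_of_col_zero hT hs0 hu hu' d2 h3)
    omega
  have d4 : T.dist u' s = T.dist w s + 1 := by
    have h1 := dist_le_dist_add_one hT hw s
    have t := hT.dist_triangle (u := w) (v := r) (w := s)
    rw [SimpleGraph.dist_eq_one_iff_adj.2 hs] at t
    omega
  exact hwv (hSh.unique_of_col_zero hT hs0 hw hu'.symm d4 d3)

theorem IsShadow.isTreeDist {Y : Type*} {Sh : V → V → Set Y} (hSh : IsShadow T col Sh)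
    (hT : T.Connected) (hcol : ∀ u v, T.Adj u v → (col u + col v) % 2 = 1)
    (hcol' : ∀ v, col v = 0 ∨ col v = 1) : IsTreeDist T.dist col where
  eq_of_zero _ _ h := hT.dist_eq_zero_iff.1 h
  self _ := SimpleGraph.dist_self
  comm _ _ := T.dist_comm
  tri _ _ _ := hT.dist_triangle
  four x y z w := four_point hT hcol
    (fun _ _ _ _ hu hu' h h' => hSh.unique hT hcol hcol' hu hu' h h') y z w _ x rfl
  between x y k hk := by
    induction k with
    | zero => exact ⟨x, by simp, by simp⟩
    | succ k ih =>
      obtain ⟨z, hz1, hz2⟩ := ih (by omega)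
      obtain ⟨w, hw, hwy⟩ := exists_adj_dist hT (v := z) (r := y)
        (by rintro rfl; simp at hz2; omega)
      refine ⟨w, ?_, by omega⟩
      have h1 := dist_le_dist_add_one hT hw.symm x
      have h2 := hT.dist_triangle (u := x) (v := w) (w := y)
      rw [T.dist_comm (u := w), T.dist_comm (u := z) (v := x)] at h1
      omega
  parity := dist_parity hT hcol

theorem graph_dist_smul {G : Type*} [Group G] [MulAction G V]
    (h : ∀ (g : G) u v, T.Adj u v → T.Adj (g • u) (g • v)) (hT : T.Connected) (g : G) (x y : V) :
    T.dist (g • x) (g • y) = T.dist x y := by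
  have key : ∀ (g : G) x y, T.dist (g • x) (g • y) ≤ T.dist x y := by
    intro g x y
    obtain ⟨p, hp⟩ := hT.exists_walk_length_eq_dist x y
    let f : T →g T := ⟨fun v => g • v, fun h' => h g _ _ h'⟩
    have := SimpleGraph.dist_le (p.map f)
    rwa [SimpleGraph.Walk.length_map, hp] at this
  refine le_antisymm (key g x y) ?_
  have := key g⁻¹ (g • x) (g • y)
  rwa [inv_smul_smul, inv_smul_smul] at this

end Graph

/-! ### Amalgams -/

/-- A group generated by `G` and groups `B i`, each amalgamated with `G` along a subgroup `D i`,
with an action on a set `Y` in which they play ping-pong. -/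
structure Amalgam {G I : Type u} [Group G] (D : I → Subgroup G) {B : I → Type u}
    [∀ i, Group (B i)] (j : ∀ i, D i →* B i) where
  /-- the amalgam -/
  Γ : Type u
  [grp : Group Γ]
  /-- the inclusion of `G` -/
  φ : G →* Γ
  /-- the inclusions of the groups `B i` -/
  ψ : ∀ i, B i →* Γ
  compat : ∀ i (h : D i), ψ i (j i h) = φ h
  closure_eq_top : Subgroup.closure (Set.range φ ∪ ⋃ i, Set.range (ψ i)) = ⊤
  /-- the set acted upon -/
  Y : Type u
  [act : MulAction Γ Y]
  /-- the ping-pong table -/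
  U : I → Set Y
  /-- the base point -/
  o : Y
  ping : ∀ i b, b ∉ (j i).range → ∀ y, y ∉ U i → ψ i b • y ∈ U i
  pong : ∀ i i' g y, y ∈ U i → φ g • y ∈ U i' → i = i' ∧ g ∈ D i
  smul_mem : ∀ i, ∀ g ∈ D i, ∀ y ∈ U i, φ g • y ∈ U i
  smul_base_notMem : ∀ g i, φ g • o ∉ U i
  eq_one_of_smul_base : ∀ g, φ g • o = o → g = 1

attribute [instance] Amalgam.grp Amalgam.act

/-- A group is a disjoint union of left cosets of the image of an injective homomorphism. -/
theorem exists_coset_equiv {D B : Type*} [Group D] [Group B] (j : D →* B)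
    (hj : Function.Injective j) :
    ∃ E : B ≃ D × (B ⧸ j.range), (∀ b h, E (b * j h) = ((E b).1 * h, (E b).2)) ∧
      ∀ b, (E b).2 = b := by
  have h : ∀ b : B, ∃ h : D, j h = (b : B ⧸ j.range).out⁻¹ * b := by
    intro b
    exact QuotientGroup.eq.1 (QuotientGroup.out_eq' (b : B ⧸ j.range))
  choose f hf using h
  refine ⟨⟨fun b => (f b, b), fun p => p.2.out * j p.1, ?_, ?_⟩, ?_, fun _ => rfl⟩
  · intro b
    simp [hf]
  · rintro ⟨h, q⟩
    have hq : ((q.out * j h : B) : B ⧸ j.range) = q := by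
      conv_rhs => rw [← QuotientGroup.out_eq' q]
      rw [QuotientGroup.eq]
      simp
    refine Prod.ext ?_ hq
    apply hj
    change j (f (q.out * j h)) = j h
    rw [hf, hq]
    simp
  · intro b h
    have hq : ((b * j h : B) : B ⧸ j.range) = b := by
      rw [QuotientGroup.eq]
      simp
    refine Prod.ext ?_ hq
    apply hj
    change j (f (b * j h)) = j (f b * h)
    rw [map_mul, hf, hf, hq, mul_assoc]

theorem nonempty_equiv_of_card {S K : Type u} [Infinite K] (f : K → S)
    (hf : Function.Injective f) (hS : Cardinal.mk S ≤ Cardinal.mk K) : Nonempty (S ≃ K) :=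
  Cardinal.eq.1 (le_antisymm hS (Cardinal.mk_le_of_injective hf))

/-- Types of the same infinite cardinality are equivalent by a map that matches two
predicates, provided all four parts have full cardinality. -/
theorem exists_equiv_of_card {S R K : Type u} [Infinite K] (P : S → Prop) (Q : R → Prop)
    (hS : Cardinal.mk S ≤ Cardinal.mk K) (hR : Cardinal.mk R ≤ Cardinal.mk K)
    (f₁ : K → S) (hf₁ : Function.Injective f₁) (hP₁ : ∀ k, P (f₁ k))
    (f₂ : K → S) (hf₂ : Function.Injective f₂) (hP₂ : ∀ k, ¬ P (f₂ k))
    (f₃ : K → R) (hf₃ : Function.Injective f₃) (hQ₃ : ∀ k, Q (f₃ k))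
    (f₄ : K → R) (hf₄ : Function.Injective f₄) (hQ₄ : ∀ k, ¬ Q (f₄ k)) :
    ∃ F : S ≃ R, ∀ s, Q (F s) ↔ P s := by
  classical
  obtain ⟨e₁⟩ := nonempty_equiv_of_card (S := {s // P s}) (K := K) (fun k => ⟨f₁ k, hP₁ k⟩)
    (fun a b h => hf₁ (congrArg Subtype.val h)) ((Cardinal.mk_subtype_le _).trans hS)
  obtain ⟨e₂⟩ := nonempty_equiv_of_card (S := {s // ¬ P s}) (K := K) (fun k => ⟨f₂ k, hP₂ k⟩)
    (fun a b h => hf₂ (congrArg Subtype.val h)) ((Cardinal.mk_subtype_le _).trans hS)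
  obtain ⟨e₃⟩ := nonempty_equiv_of_card (S := {s // Q s}) (K := K) (fun k => ⟨f₃ k, hQ₃ k⟩)
    (fun a b h => hf₃ (congrArg Subtype.val h)) ((Cardinal.mk_subtype_le _).trans hR)
  obtain ⟨e₄⟩ := nonempty_equiv_of_card (S := {s // ¬ Q s}) (K := K) (fun k => ⟨f₄ k, hQ₄ k⟩)
    (fun a b h => hf₄ (congrArg Subtype.val h)) ((Cardinal.mk_subtype_le _).trans hR)
  refine ⟨(Equiv.sumCompl P).symm.trans
    ((Equiv.sumCongr (e₁.trans e₃.symm) (e₂.trans e₄.symm)).trans (Equiv.sumCompl Q)), ?_⟩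
  intro s
  by_cases hs : P s
  · simp only [Equiv.trans_apply, Equiv.sumCompl_symm_apply_of_pos hs, Equiv.sumCongr_apply,
      Sum.map_inl, Equiv.sumCompl_apply_inl, hs, iff_true]
    exact Subtype.property _
  · simp only [Equiv.trans_apply, Equiv.sumCompl_symm_apply_of_neg hs, Equiv.sumCongr_apply,
      Sum.map_inr, Equiv.sumCompl_apply_inr, hs, iff_false]
    exact (e₄.symm (e₂ ⟨s, hs⟩)).property

/-- `G` acts freely on `Y = G × (Option I × K)` by right translation, and `B i` on `B i × K`. As `D
i`-sets both are free with `|K|` orbits, so a `D i`-equivariant bijection carries the action of `B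
i` to `Y`. It is chosen to match the sheet `U i`, with `G`-coordinate in `D i` and label `some i`,
with the complement of `(j i).range × K`; elements of `B i` outside `D i` then push the complement
of `U i` into `U i`. -/
theorem Amalgam.nonempty {G I : Type u} [Group G] (D : I → Subgroup G) {B : I → Type u}
    [∀ i, Group (B i)] (j : ∀ i, D i →* B i) (hj : ∀ i, Function.Injective (j i))
    (hj' : ∀ i, ∃ b, b ∉ (j i).range) : Nonempty (Amalgam D j) := by
  classical
  -- Any infinite set at least as large as `I`, `G` and all `B i` would do.
  let K : Type u := ℕ ⊕ (I ⊕ (G ⊕ (Σ i, B i)))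
  have hKinf : Cardinal.aleph0 ≤ Cardinal.mk K := Cardinal.aleph0_le_mk K
  have hI : Cardinal.mk (Option I) ≤ Cardinal.mk K := by
    refine Cardinal.mk_le_of_injective
      (f := fun o : Option I => (o.elim (Sum.inl 0) (fun i => Sum.inr (Sum.inl i)) : K)) ?_
    rintro (_ | a) (_ | b) h
    · rfl
    · exact absurd h Sum.inl_ne_inr
    · exact absurd h Sum.inr_ne_inl
    · exact congrArg some (Sum.inl_injective (Sum.inr_injective h))
  have hG : Cardinal.mk G ≤ Cardinal.mk K :=
    Cardinal.mk_le_of_injective (f := fun g : G => (Sum.inr (Sum.inr (Sum.inl g)) : K))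
      (fun a b h => Sum.inl_injective (Sum.inr_injective (Sum.inr_injective h)))
  have hB : ∀ i, Cardinal.mk (B i) ≤ Cardinal.mk K := fun i =>
    Cardinal.mk_le_of_injective (f := fun b : B i => (Sum.inr (Sum.inr (Sum.inr ⟨i, b⟩)) : K))
      (fun a b h => sigma_mk_injective
        (Sum.inr_injective (Sum.inr_injective (Sum.inr_injective h))))
  have hprod : ∀ {X Z : Type u}, Cardinal.mk X ≤ Cardinal.mk K → Cardinal.mk Z ≤ Cardinal.mk K →
      Cardinal.mk (X × Z) ≤ Cardinal.mk K := by
    intro X Z h1 h2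
    rw [Cardinal.mk_prod, Cardinal.lift_id, Cardinal.lift_id]
    exact Cardinal.mul_le_of_le hKinf h1 h2
  have hquot : ∀ {X : Type u} [Group X] (H : Subgroup X), Cardinal.mk X ≤ Cardinal.mk K →
      Cardinal.mk (X ⧸ H) ≤ Cardinal.mk K := fun H h =>
    (Cardinal.mk_le_of_surjective (QuotientGroup.mk_surjective (s := H))).trans h
  -- the `D i`-equivariant bijections
  have main : ∀ i, ∃ e : G × (Option I × K) ≃ B i × K,
      (∀ (g : G) w (h : D i), e (g * h, w) = ((e (g, w)).1 * j i h, (e (g, w)).2)) ∧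
      ∀ g w, (e (g, w)).1 ∈ (j i).range ↔ ¬ (g ∈ D i ∧ w.1 = some i) := by
    intro i
    obtain ⟨E, hE1, hE2⟩ := exists_coset_equiv (D i).subtype (D i).subtype_injective
    obtain ⟨E', hE1', hE2'⟩ := exists_coset_equiv (j i) (hj i)
    obtain ⟨b, hb⟩ := hj' i
    -- A bijection of the sets of `D i`-orbits. The label `none` provides `|K|` orbits outside `U
    -- i`, and the element `b` provides `|K|` orbits outside the identity coset.
    obtain ⟨F, hF⟩ := exists_equiv_of_card (K := K)
      (S := (G ⧸ (D i).subtype.range) × (Option I × K)) (R := (B i ⧸ (j i).range) × K)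
      (fun p => ¬ (p.1 = ((1 : G) : G ⧸ (D i).subtype.range) ∧ p.2.1 = some i))
      (fun q => q.1 = ((1 : B i) : B i ⧸ (j i).range))
      (hprod (hquot _ hG) (hprod hI le_rfl)) (hprod (hquot _ (hB i)) le_rfl)
      (fun k => (((1 : G) : G ⧸ (D i).subtype.range), (none, k)))
      (fun a b h => by simpa using h) (fun k => by simp)
      (fun k => (((1 : G) : G ⧸ (D i).subtype.range), (some i, k)))
      (fun a b h => by simpa using h) (fun k => by simp)
      (fun k => (((1 : B i) : B i ⧸ (j i).range), k))
      (fun a b h => by simpa using h) (fun k => rfl)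
      (fun k => ((b : B i ⧸ (j i).range), k))
      (fun a b h => by simpa using h) (fun k h => hb (by
        have := QuotientGroup.eq.1 (Eq.symm h)
        simpa using this))
    let e : G × (Option I × K) ≃ B i × K :=
      { toFun := fun p =>
          (E'.symm ((E p.1).1, (F ((E p.1).2, p.2)).1), (F ((E p.1).2, p.2)).2)
        invFun := fun q => (E.symm ((E' q.1).1, (F.symm ((E' q.1).2, q.2)).1),
          (F.symm ((E' q.1).2, q.2)).2)
        left_inv := fun p => by simp
        right_inv := fun q => by simp }
    have he1 : ∀ p, (e p).1 = E'.symm ((E p.1).1, (F ((E p.1).2, p.2)).1) := fun _ => rfl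
    have he2 : ∀ p, (e p).2 = (F ((E p.1).2, p.2)).2 := fun _ => rfl
    refine ⟨e, ?_, ?_⟩
    · intro g w h
      have h1 : E (g * h) = ((E g).1 * h, (E g).2) := hE1 g h
      refine Prod.ext ?_ ?_
      · apply E'.injective
        simp only [he1, hE1', h1, Equiv.apply_symm_apply]
      · simp only [he2, h1]
    · intro g w
      have h1 : (e (g, w)).1 ∈ (j i).range ↔
          (((e (g, w)).1 : B i) : B i ⧸ (j i).range) = ((1 : B i) : B i ⧸ (j i).range) := by
        rw [eq_comm, QuotientGroup.eq]
        simp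
      rw [h1, ← hE2', he1, Equiv.apply_symm_apply]
      refine (hF _).trans ?_
      rw [hE2, eq_comm (a := ((g : G) : G ⧸ (D i).subtype.range)), QuotientGroup.eq]
      simp
  choose e he1 he2 using main
  let Y := G × (Option I × K)
  let φ₀ : G →* Equiv.Perm Y :=
    { toFun := fun g => ⟨fun p => (p.1 * g⁻¹, p.2), fun p => (p.1 * g, p.2),
        fun p => by simp, fun p => by simp⟩
      map_one' := by ext p <;> simp
      map_mul' := fun a b => by ext p <;> simp [mul_assoc] }
  let ψ₀ : ∀ i, B i →* Equiv.Perm Y := fun i =>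
    { toFun := fun b => ⟨fun p => (e i).symm ((e i p).1 * b⁻¹, (e i p).2),
        fun p => (e i).symm ((e i p).1 * b, (e i p).2), fun p => by simp, fun p => by simp⟩
      map_one' := by ext p <;> simp
      map_mul' := fun a b => by ext p <;> simp [mul_assoc] }
  have hφ₀ : ∀ g p, φ₀ g p = (p.1 * g⁻¹, p.2) := fun _ _ => rfl
  have hψ₀ : ∀ i b p, e i (ψ₀ i b p) = ((e i p).1 * b⁻¹, (e i p).2) := fun i b p =>
    (e i).apply_symm_apply _
  let X : Set (Equiv.Perm Y) := Set.range φ₀ ∪ ⋃ i, Set.range (ψ₀ i)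
  let φ : G →* Subgroup.closure X := φ₀.codRestrict _ fun g =>
    Subgroup.subset_closure (Or.inl ⟨g, rfl⟩)
  let ψ : ∀ i, B i →* Subgroup.closure X := fun i => (ψ₀ i).codRestrict _ fun b =>
    Subgroup.subset_closure (Or.inr (Set.mem_iUnion.2 ⟨i, b, rfl⟩))
  refine ⟨{
    Γ := Subgroup.closure X
    φ := φ
    ψ := ψ
    compat := ?_
    closure_eq_top := ?_
    Y := Y
    U := fun i => {p | p.1 ∈ D i ∧ p.2.1 = some i}
    o := (1, (none, Sum.inl 0))
    ping := ?_
    pong := ?_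
    smul_mem := ?_
    smul_base_notMem := ?_
    eq_one_of_smul_base := ?_ }⟩
  · intro i h
    apply Subtype.ext
    ext1 p
    change ψ₀ i (j i h) p = φ₀ h p
    apply (e i).injective
    rw [hψ₀, hφ₀]
    have := he1 i p.1 p.2 h⁻¹
    rw [map_inv] at this
    exact this.symm
  · rw [eq_top_iff, ← Subgroup.closure_closure_coe_preimage (k := X)]
    apply Subgroup.closure_mono
    rintro ⟨x, hx⟩ (⟨g, hg⟩ | hx')
    · exact Or.inl ⟨g, Subtype.ext hg⟩
    · obtain ⟨i, b, hb⟩ := Set.mem_iUnion.1 hx'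
      exact Or.inr (Set.mem_iUnion.2 ⟨i, b, Subtype.ext hb⟩)
  · intro i b hb p hp
    change ψ₀ i b p ∈ {p : Y | p.1 ∈ D i ∧ p.2.1 = some i}
    have h1 := (he2 i p.1 p.2).2 hp
    by_contra h2
    have h3 := (he2 i _ _).2 h2
    change (e i (ψ₀ i b p)).1 ∈ (j i).range at h3
    rw [hψ₀] at h3
    exact hb (by simpa using (Subgroup.mul_mem_cancel_left _ h1).1 h3)
  · rintro i i' g p ⟨hp1, hp2⟩ ⟨h1, h2⟩
    change p.2.1 = some i' at h2
    change p.1 * g⁻¹ ∈ D i' at h1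
    obtain rfl : i = i' := by
      rw [hp2] at h2
      exact Option.some_injective _ h2
    exact ⟨rfl, by simpa using (Subgroup.mul_mem_cancel_left _ hp1).1 h1⟩
  · rintro i g hg p ⟨hp1, hp2⟩
    exact ⟨(D i).mul_mem hp1 ((D i).inv_mem hg), hp2⟩
  · rintro g i ⟨-, h⟩
    exact Option.some_ne_none i h.symm
  · intro g h
    have h1 : (1 : G) * g⁻¹ = 1 := congrArg Prod.fst h
    simpa using h1

/-! ### The tree of an amalgam -/

namespace Amalgam

variable {G I : Type u} [Group G] {D : I → Subgroup G} {B : I → Type u}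
  [∀ i, Group (B i)] {j : ∀ i, D i →* B i} (A : Amalgam D j)

theorem φ_injective : Function.Injective A.φ := by
  rw [injective_iff_map_eq_one]
  intro g hg
  apply A.eq_one_of_smul_base
  rw [hg, one_smul]

theorem base_notMem (i : I) : A.o ∉ A.U i := by
  have := A.smul_base_notMem 1 i
  rwa [map_one, one_smul] at this

/-- Outside `D i`, elements of `B i` move the base point into `U i`, where no element of `G` takes
it. So the factors meet only in `D i`. -/
theorem mem_of_φ_eq_ψ {i : I} {g : G} {b : B i} (h : A.φ g = A.ψ i b) :
    ∃ d : D i, g = d ∧ b = j i d := by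
  by_cases hb : b ∈ (j i).range
  · obtain ⟨d, rfl⟩ := hb
    rw [A.compat] at h
    exact ⟨d, A.φ_injective h, rfl⟩
  · have := A.ping i b hb A.o (A.base_notMem i)
    rw [← h] at this
    exact absurd this (A.smul_base_notMem g i)

theorem ψ_injective (i : I) : Function.Injective (A.ψ i) := by
  rw [injective_iff_map_eq_one]
  intro b hb
  obtain ⟨d, h1, h2⟩ := A.mem_of_φ_eq_ψ (g := 1) (b := b) (by rw [hb, map_one])
  rw [h2, show d = 1 from Subtype.ext h1.symm, map_one]

/-- The vertices of the tree of the amalgam. -/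
abbrev Vertex : Type u := (A.Γ ⧸ A.φ.range) ⊕ (Σ i, A.Γ ⧸ (A.ψ i).range)

/-- The vertex `γ G`. -/
def left (γ : A.Γ) : A.Vertex := Sum.inl γ

/-- The vertex `γ (B i)`. -/
def right (i : I) (γ : A.Γ) : A.Vertex := Sum.inr ⟨i, γ⟩

theorem smul_left (γ δ : A.Γ) : γ • A.left δ = A.left (γ * δ) := rfl

theorem smul_right (i : I) (γ δ : A.Γ) : γ • A.right i δ = A.right i (γ * δ) := rfl

theorem left_eq {γ δ : A.Γ} : A.left γ = A.left δ ↔ ∃ g, δ = γ * A.φ g := by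
  unfold left
  rw [Sum.inl.injEq, QuotientGroup.eq, MonoidHom.mem_range]
  exact exists_congr fun g => by rw [eq_inv_mul_iff_mul_eq, eq_comm]

theorem right_eq {i i' : I} {γ δ : A.Γ} :
    A.right i γ = A.right i' δ ↔ i = i' ∧ ∃ b, δ = γ * A.ψ i b := by
  unfold right
  rw [Sum.inr.injEq]
  constructor
  · intro h
    obtain rfl : i = i' := congrArg Sigma.fst h
    have h2 := sigma_mk_injective h
    rw [QuotientGroup.eq, MonoidHom.mem_range] at h2
    exact ⟨rfl, h2.imp fun g => by rw [eq_inv_mul_iff_mul_eq, eq_comm]; exact id⟩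
  · rintro ⟨rfl, b, rfl⟩
    congr 1
    rw [QuotientGroup.eq]
    simp

theorem left_ne_right {i : I} {γ δ : A.Γ} : A.left γ ≠ A.right i δ := Sum.inl_ne_inr

/-- Edges are cosets of the `D i`; this makes shadows independent of representatives. -/
theorem edge_eq {i i' : I} {γ δ : A.Γ} (h : A.left γ = A.left δ)
    (h' : A.right i γ = A.right i' δ) : i = i' ∧ ∃ d : D i, δ = γ * A.φ d := by
  obtain ⟨g, hg⟩ := A.left_eq.1 h
  obtain ⟨rfl, b, hb⟩ := A.right_eq.1 h'
  refine ⟨rfl, ?_⟩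
  obtain ⟨d, h1, -⟩ := A.mem_of_φ_eq_ψ (mul_left_cancel (hg.symm.trans hb))
  exact ⟨d, by rw [hg, h1]⟩

/-- The tree of the amalgam. -/
def tree : SimpleGraph A.Vertex where
  Adj u v := (∃ i γ, u = A.left γ ∧ v = A.right i γ) ∨ (∃ i γ, v = A.left γ ∧ u = A.right i γ)
  symm := ⟨fun _ _ h => h.symm⟩
  loopless := ⟨by
    rintro v (⟨i, γ, h1, h2⟩ | ⟨i, γ, h1, h2⟩) <;>
    exact A.left_ne_right (h1.symm.trans h2)⟩

/-- The colouring of the tree. -/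
def colour : A.Vertex → ℕ := Sum.elim (fun _ => 0) (fun _ => 1)

theorem adj_left_right (i : I) (γ : A.Γ) : A.tree.Adj (A.left γ) (A.right i γ) :=
  Or.inl ⟨i, γ, rfl, rfl⟩

theorem exists_of_adj_left {γ : A.Γ} {v : A.Vertex} (h : A.tree.Adj (A.left γ) v) :
    ∃ i g, v = A.right i (γ * A.φ g) := by
  rcases h with ⟨i, δ, h1, h2⟩ | ⟨i, δ, h1, h2⟩
  · obtain ⟨g, rfl⟩ := A.left_eq.1 h1
    exact ⟨i, g, h2⟩
  · exact absurd h2 A.left_ne_right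

theorem exists_of_adj_right {i : I} {γ : A.Γ} {v : A.Vertex}
    (h : A.tree.Adj (A.right i γ) v) : ∃ b, v = A.left (γ * A.ψ i b) := by
  rcases h with ⟨i', δ, h1, h2⟩ | ⟨i', δ, h1, h2⟩
  · exact absurd h1.symm A.left_ne_right
  · obtain ⟨rfl, b, rfl⟩ := A.right_eq.1 h2
    exact ⟨b, h1⟩

theorem vertex_cases (v : A.Vertex) : (∃ γ, v = A.left γ) ∨ ∃ i γ, v = A.right i γ := by
  rcases v with v | ⟨i, v⟩
  · obtain ⟨γ, rfl⟩ := QuotientGroup.mk_surjective v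
    exact Or.inl ⟨γ, rfl⟩
  · obtain ⟨γ, rfl⟩ := QuotientGroup.mk_surjective v
    exact Or.inr ⟨i, γ, rfl⟩

theorem colour_right (i : I) (γ : A.Γ) : A.colour (A.right i γ) = 1 := rfl

theorem colour_eq (v : A.Vertex) : A.colour v = 0 ∨ A.colour v = 1 := by
  rcases v with v | v
  · exact Or.inl rfl
  · exact Or.inr rfl

theorem colour_adj (u v : A.Vertex) (h : A.tree.Adj u v) :
    (A.colour u + A.colour v) % 2 = 1 := by
  rcases h with ⟨i, γ, rfl, rfl⟩ | ⟨i, γ, rfl, rfl⟩ <;> rfl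

theorem colour_smul (γ : A.Γ) (v : A.Vertex) : A.colour (γ • v) = A.colour v := by
  rcases v with v | v <;> rfl

theorem adj_smul (γ : A.Γ) (u v : A.Vertex) (h : A.tree.Adj u v) :
    A.tree.Adj (γ • u) (γ • v) := by
  rcases h with ⟨i, δ, rfl, rfl⟩ | ⟨i, δ, rfl, rfl⟩
  · exact A.adj_left_right i (γ * δ)
  · exact (A.adj_left_right i (γ * δ)).symm

theorem tree_connected : A.tree.Connected := by
  have key : ∀ γ : A.Γ, ∀ δ, A.tree.Reachable (A.left δ) (A.left (δ * γ)) := by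
    intro γ
    have hγ : γ ∈ Subgroup.closure (Set.range A.φ ∪ ⋃ i, Set.range (A.ψ i)) := by
      rw [A.closure_eq_top]
      trivial
    induction hγ using Subgroup.closure_induction with
    | mem x hx =>
      intro δ
      rcases hx with ⟨g, rfl⟩ | hx
      · rw [A.left_eq.2 ⟨g, rfl⟩]
      · obtain ⟨i, b, rfl⟩ := Set.mem_iUnion.1 hx
        refine (A.adj_left_right i δ).reachable.trans ?_
        rw [A.right_eq.2 ⟨rfl, b, rfl⟩]
        exact (A.adj_left_right i _).symm.reachable
    | one => intro δ; rw [mul_one]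
    | mul x y _ _ hx hy =>
      intro δ
      rw [← mul_assoc]
      exact (hx δ).trans (hy _)
    | inv x _ hx =>
      intro δ
      have := hx (δ * x⁻¹)
      rw [inv_mul_cancel_right] at this
      exact this.symm
  have key' : ∀ v, A.tree.Reachable (A.left 1) v := by
    intro v
    rcases A.vertex_cases v with ⟨γ, rfl⟩ | ⟨i, γ, rfl⟩
    · simpa using key γ 1
    · have := key γ 1
      rw [one_mul] at this
      exact this.trans (A.adj_left_right i γ).reachable
  have : Nonempty A.Vertex := ⟨A.left 1⟩
  exact ⟨fun u v => (key' u).symm.trans (key' v)⟩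

/-- The shadows of the oriented edges of the tree. -/
def shadow (u v : A.Vertex) : Set A.Y :=
  {y | (∃ i γ, u = A.left γ ∧ v = A.right i γ ∧ γ⁻¹ • y ∈ A.U i) ∨
    (∃ i γ, v = A.left γ ∧ u = A.right i γ ∧ γ⁻¹ • y ∉ A.U i)}

theorem smul_mem_iff {i : I} {g : G} (hg : g ∈ D i) {y : A.Y} :
    A.φ g • y ∈ A.U i ↔ y ∈ A.U i := by
  refine ⟨fun h => ?_, A.smul_mem i g hg y⟩
  have := A.smul_mem i g⁻¹ ((D i).inv_mem hg) _ h
  rwa [smul_smul, ← map_mul, inv_mul_cancel, map_one, one_smul] at this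

theorem mem_shadow_left {i : I} {γ : A.Γ} {y : A.Y} :
    y ∈ A.shadow (A.left γ) (A.right i γ) ↔ γ⁻¹ • y ∈ A.U i := by
  constructor
  · rintro (⟨i', δ, h1, h2, h3⟩ | ⟨i', δ, h1, h2, h3⟩)
    · obtain ⟨rfl, d, rfl⟩ := A.edge_eq h1 h2
      rw [mul_inv_rev, mul_smul, ← map_inv] at h3
      exact (A.smul_mem_iff ((D i).inv_mem d.2)).1 h3
    · exact absurd h2 A.left_ne_right
  · intro h
    exact Or.inl ⟨i, γ, rfl, rfl, h⟩

theorem mem_shadow_right {i : I} {γ : A.Γ} {y : A.Y} :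
    y ∈ A.shadow (A.right i γ) (A.left γ) ↔ γ⁻¹ • y ∉ A.U i := by
  constructor
  · rintro (⟨i', δ, h1, h2, h3⟩ | ⟨i', δ, h1, h2, h3⟩)
    · exact absurd h1.symm A.left_ne_right
    · obtain ⟨rfl, d, rfl⟩ := A.edge_eq h1 h2
      rw [mul_inv_rev, mul_smul, ← map_inv] at h3
      exact fun h => h3 ((A.smul_mem_iff ((D i).inv_mem d.2)).2 h)
  · intro h
    exact Or.inr ⟨i, γ, rfl, rfl, h⟩

/-- Shadows are translates of the `U i` and their complements. Disjointness is `pong` at the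
vertices `γ G` and `ping` at the vertices `γ (B i)`; translates of `o` are the base points. -/
theorem isShadow : IsShadow A.tree A.colour A.shadow where
  compl u v h := by
    rcases h with ⟨i, γ, rfl, rfl⟩ | ⟨i, γ, rfl, rfl⟩ <;> ext y
    · rw [Set.mem_compl_iff, A.mem_shadow_left, A.mem_shadow_right, not_not]
    · rw [Set.mem_compl_iff, A.mem_shadow_left, A.mem_shadow_right]
  disj v u u' hu hu' hne := by
    rw [Set.disjoint_left]
    intro y h h'
    rcases A.vertex_cases v with ⟨γ, rfl⟩ | ⟨i, γ, rfl⟩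
    · obtain ⟨i, g, rfl⟩ := A.exists_of_adj_left hu
      obtain ⟨i', g', rfl⟩ := A.exists_of_adj_left hu'
      rw [A.left_eq.2 ⟨g, rfl⟩, A.mem_shadow_left] at h
      rw [A.left_eq.2 ⟨g', rfl⟩, A.mem_shadow_left] at h'
      obtain ⟨rfl, hg⟩ := A.pong i i' (g'⁻¹ * g) _ h (by
        rw [smul_smul]
        convert h' using 2
        simp only [map_mul, map_inv]
        group)
      apply hne
      rw [A.right_eq]
      refine ⟨rfl, j i ⟨_, (D i).inv_mem hg⟩, ?_⟩
      rw [A.compat]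
      simp only [map_mul, map_inv]
      group
    · obtain ⟨b, rfl⟩ := A.exists_of_adj_right hu
      obtain ⟨b', rfl⟩ := A.exists_of_adj_right hu'
      rw [A.right_eq.2 ⟨rfl, b, rfl⟩, A.mem_shadow_right] at h
      rw [A.right_eq.2 ⟨rfl, b', rfl⟩, A.mem_shadow_right] at h'
      by_cases hb : b'⁻¹ * b ∈ (j i).range
      · obtain ⟨d, hd⟩ := hb
        apply hne
        rw [A.left_eq]
        refine ⟨(d⁻¹ : D i), ?_⟩
        rw [← A.compat, map_inv, hd]
        simp only [map_mul, map_inv]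
        group
      · apply h'
        have := A.ping i _ hb _ h
        rw [smul_smul] at this
        convert this using 2
        simp only [map_mul, map_inv]
        group
  base v hv := by
    rcases A.vertex_cases v with ⟨γ, rfl⟩ | ⟨i, γ, rfl⟩
    · refine ⟨γ • A.o, fun u hu h => ?_⟩
      obtain ⟨i, g, rfl⟩ := A.exists_of_adj_left hu
      rw [A.left_eq.2 ⟨g, rfl⟩, A.mem_shadow_left, smul_smul, mul_inv_rev,
        inv_mul_cancel_right, ← map_inv] at h
      exact A.smul_base_notMem _ _ h
    · rw [A.colour_right] at hv
      omega

theorem isTreeAction : IsTreeAction A.Γ A.tree.dist A.colour where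
  toIsTreeDist := A.isShadow.isTreeDist A.tree_connected A.colour_adj A.colour_eq
  isom := graph_dist_smul A.adj_smul A.tree_connected
  col_smul := A.colour_smul

/-! ### Membership of the amalgam in `𝒫_π` -/

variable {π : Set Nat.Primes}

/-- The amalgam lies in `𝒫_π` if its constituents are glued along almost malnormal subgroups
and the elements of the constituents have unique roots. -/
theorem inClassPPi (C : I → Subgroup G)
    (hUG : IsUPiGroup π G) (hUB : ∀ i, IsUPiGroup π (B i))
    (hRG : ∀ (g : G) m, IsPiPrimeNumber π m → ∃ y, y ^ m = A.φ g)
    (hRB : ∀ i (b : B i) m, IsPiPrimeNumber π m → ∃ y, y ^ m = b)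
    (hC : ∀ i i' g c, c ∈ C i → c ≠ 1 → g⁻¹ * c * g ∈ D i' → i = i' ∧ g ∈ D i)
    (hD : ∀ i, ∀ h ∈ D i, h ∉ C i → h * h = 1)
    (hDB : ∀ i (h h' : D i) b, (h : G) ∉ C i → b⁻¹ * j i h * b = j i h' → b ∈ (j i).range) :
    InClassPPi π A.Γ := by
  have : Nonempty A.Vertex := ⟨A.left 1⟩
  have hleft : ∀ {x γ : A.Γ}, x • A.left γ = A.left γ → ∃ g, x = γ * A.φ g * γ⁻¹ := by
    intro x γ h
    rw [A.smul_left] at h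
    obtain ⟨g, hg⟩ := A.left_eq.1 h.symm
    exact ⟨g, by rw [← hg, mul_inv_cancel_right]⟩
  have hright : ∀ {x γ : A.Γ} {i}, x • A.right i γ = A.right i γ →
      ∃ b, x = γ * A.ψ i b * γ⁻¹ := by
    intro x γ i h
    rw [A.smul_right] at h
    obtain ⟨-, b, hb⟩ := A.right_eq.1 h.symm
    exact ⟨b, by rw [← hb, mul_inv_cancel_right]⟩
  refine A.isTreeAction.inClassPPi A.colour_eq ?_ ?_ ?_
  · intro u v h huv hu hhu hhv hne
    rw [SimpleGraph.dist_eq_one_iff_adj] at huv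
    obtain ⟨i, γ, rfl, rfl⟩ : ∃ i γ, u = A.left γ ∧ v = A.right i γ := by
      rcases huv with huv | ⟨i, γ, rfl, rfl⟩
      · exact huv
      · rw [A.colour_right] at hu
        omega
    obtain ⟨g, hg⟩ := hleft hhu
    obtain ⟨b, hb⟩ := hright hhv
    obtain ⟨d, hgd, hbd⟩ : ∃ d : D i, g = d ∧ b = j i d := A.mem_of_φ_eq_ψ (by
      rw [hg] at hb
      exact mul_left_cancel (mul_right_cancel hb))
    subst hgd
    have hd1 : (d : G) ≠ 1 := by
      intro h1
      apply hne
      rw [hg, h1]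
      simp
    -- Elements of `C i` fix a single edge at the `G`-vertex, by `hC`. The others are involutions
    -- fixing a single edge at the `B i`-vertex, by `hDB`.
    by_cases hdC : (d : G) ∈ C i
    · left
      intro v' hv' hhv'
      rw [SimpleGraph.dist_eq_one_iff_adj] at hv'
      obtain ⟨i', g', rfl⟩ := A.exists_of_adj_left hv'
      obtain ⟨b', hb'⟩ := hright hhv'
      obtain ⟨d', hd'⟩ : ∃ d' : D i', g'⁻¹ * d * g' = d' := by
        obtain ⟨d', h1, -⟩ := A.mem_of_φ_eq_ψ (g := g'⁻¹ * d * g') (b := b') (by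
          rw [hg] at hb'
          have h2 : A.φ d = A.φ g' * A.ψ i' b' * (A.φ g')⁻¹ := by
            have h3 := congrArg (fun z => γ⁻¹ * z * γ) hb'
            simpa [mul_assoc] using h3
          rw [map_mul, map_mul, h2, map_inv]
          group)
        exact ⟨d', h1⟩
      obtain ⟨rfl, hg'⟩ := hC i i' g' d hdC hd1 (by rw [hd']; exact d'.2)
      rw [A.right_eq]
      refine ⟨rfl, j i ⟨_, (D i).inv_mem hg'⟩, ?_⟩
      rw [A.compat]
      simp
    · right
      constructor
      · rw [hg]
        have := hD i d d.2 hdC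
        calc γ * A.φ d * γ⁻¹ * (γ * A.φ d * γ⁻¹) = γ * A.φ (d * d) * γ⁻¹ := by
              rw [map_mul]; group
          _ = 1 := by rw [this]; simp
      · intro u' hu' hhu'
        rw [SimpleGraph.dist_eq_one_iff_adj] at hu'
        obtain ⟨b', rfl⟩ := A.exists_of_adj_right hu'
        obtain ⟨g', hg'⟩ := hleft hhu'
        have h2 : A.ψ i b = A.ψ i b' * A.φ g' * (A.ψ i b')⁻¹ := by
          rw [hb] at hg'
          have h3 := congrArg (fun z => γ⁻¹ * z * γ) hg'
          simpa [mul_assoc] using h3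
        have h3 : A.φ g' = A.ψ i (b'⁻¹ * b * b') := by
          rw [map_mul, map_mul, h2, map_inv]
          group
        obtain ⟨d', hd'⟩ : ∃ d' : D i, b'⁻¹ * b * b' = j i d' := by
          obtain ⟨d', -, h⟩ := A.mem_of_φ_eq_ψ h3
          exact ⟨d', h⟩
        obtain ⟨d'', hd''⟩ := hDB i d d' b' hdC (by rw [← hbd, hd'])
        rw [A.left_eq]
        refine ⟨(d''⁻¹ : D i), ?_⟩
        rw [← A.compat, map_inv, hd'', map_inv]
        simp
  · intro v m hm x y hx hy hxy
    rcases A.vertex_cases v with ⟨γ, rfl⟩ | ⟨i, γ, rfl⟩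
    · obtain ⟨g, rfl⟩ := hleft hx
      obtain ⟨g', rfl⟩ := hleft hy
      rw [conj_pow, conj_pow, ← map_pow, ← map_pow] at hxy
      rw [hUG m hm (A.φ_injective (mul_left_cancel (mul_right_cancel hxy)))]
    · obtain ⟨g, rfl⟩ := hright hx
      obtain ⟨g', rfl⟩ := hright hy
      rw [conj_pow, conj_pow, ← map_pow, ← map_pow] at hxy
      rw [hUB i m hm (A.ψ_injective i (mul_left_cancel (mul_right_cancel hxy)))]
  · intro v m hm x hx
    rcases A.vertex_cases v with ⟨γ, rfl⟩ | ⟨i, γ, rfl⟩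
    · obtain ⟨g, rfl⟩ := hleft hx
      obtain ⟨y, hy⟩ := hRG g m hm
      exact ⟨γ * y * γ⁻¹, by rw [conj_pow, hy]⟩
    · obtain ⟨b, rfl⟩ := hright hx
      obtain ⟨y, hy⟩ := hRB i b m hm
      exact ⟨γ * A.ψ i y * γ⁻¹, by rw [conj_pow, ← map_pow, hy]⟩

end Amalgam

/-! ### Adjoining roots to a centralizer -/

theorem IsPiPrimeNumber.one (π : Set Nat.Primes) : IsPiPrimeNumber π 1 :=
  ⟨one_pos, fun p hp _ => p.2.one_lt.ne' (Nat.dvd_one.mp hp)⟩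

theorem IsPiPrimeNumber.mul {π : Set Nat.Primes} {m n : ℕ} (hm : IsPiPrimeNumber π m)
    (hn : IsPiPrimeNumber π n) : IsPiPrimeNumber π (m * n) :=
  ⟨Nat.mul_pos hm.1 hn.1, fun p hp =>
    ((Nat.Prime.dvd_mul p.2).mp hp).elim (hm.2 p) (hn.2 p)⟩

/-- The submonoid of `ℤ` of all `m ∈ π'`. -/
def piPrimeSubmonoid (π : Set Nat.Primes) : Submonoid ℤ where
  carrier := {n | ∃ m : ℕ, IsPiPrimeNumber π m ∧ n = m}
  one_mem' := ⟨1, IsPiPrimeNumber.one π, by simp⟩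
  mul_mem' := by
    rintro _ _ ⟨m, hm, rfl⟩ ⟨n, hn, rfl⟩
    exact ⟨m * n, hm.mul hn, by simp⟩

/-- The `ℤ`-module structures are arbitrary arguments, so that the statement applies to the one
carried by `LocalizedModule`; `int_smul_eq_zsmul` identifies them with integer multiples. -/
theorem localizedModule_int_aux (π : Set Nat.Primes) {M L : Type u} [AddCommGroup M]
    [AddCommGroup L] (mM : Module ℤ M) (mL : Module ℤ L) (f : M →ₗ[ℤ] L)
    (hf : IsLocalizedModule (piPrimeSubmonoid π) f)
    (hM : ∀ m, IsPiPrimeNumber π m → ∀ x : M, m • x = 0 → x = 0) :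
    Function.Injective f ∧ (∀ l : L, ∃ k, IsPiPrimeNumber π k ∧ ∃ z, k • l = f z) ∧
      (∀ m, IsPiPrimeNumber π m → Function.Bijective (fun l : L => m • l)) := by
  refine ⟨?_, ?_, ?_⟩
  · rw [injective_iff_map_eq_zero]
    intro x hx
    rw [IsLocalizedModule.eq_zero_iff (piPrimeSubmonoid π) f] at hx
    obtain ⟨⟨c, m, hm, rfl⟩, hc⟩ := hx
    apply hM m hm
    have hc' : (m : ℤ) • x = 0 := (int_smul_eq_zsmul mM (m : ℤ) x).symm.trans hc
    rwa [natCast_zsmul] at hc'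
  · intro l
    obtain ⟨⟨x, ⟨c, m, hm, rfl⟩⟩, hc⟩ := IsLocalizedModule.surj (piPrimeSubmonoid π) f l
    refine ⟨m, hm, x, ?_⟩
    have hc' : (m : ℤ) • l = f x := (int_smul_eq_zsmul mL (m : ℤ) l).symm.trans hc
    rwa [natCast_zsmul] at hc'
  · intro m hm
    have h := IsLocalizedModule.map_units f
      (⟨(m : ℤ), m, hm, rfl⟩ : piPrimeSubmonoid π)
    have := (Module.End.isUnit_iff _).1 h
    convert this using 2 with l
    rw [Module.algebraMap_end_apply]
    exact (Nat.cast_smul_eq_nsmul ℤ m l).symm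

/-- A commutative group without `π'`-torsion embeds in its `π`-localization. -/
theorem exists_commGroup_localization (π : Set Nat.Primes) (M : Type u) [CommGroup M]
    (hM : ∀ m, IsPiPrimeNumber π m → ∀ x : M, x ^ m = 1 → x = 1) :
    ∃ (L : Type u) (_ : CommGroup L) (ι : M →* L), Function.Injective ι ∧
      (∀ l : L, ∃ k, IsPiPrimeNumber π k ∧ ∃ z, l ^ k = ι z) ∧
      (∀ (l : L) m, IsPiPrimeNumber π m → ∃ y, y ^ m = l) ∧
      (∀ (l : L) m, IsPiPrimeNumber π m → l ^ m = 1 → l = 1) := by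
  let f := LocalizedModule.mkLinearMap (piPrimeSubmonoid π) (Additive M)
  obtain ⟨h1, h2, h3⟩ := localizedModule_int_aux π _ _ f
    (localizedModuleIsLocalizedModule _) (fun m hm x hx => hM m hm x.toMul hx)
  refine ⟨Multiplicative (LocalizedModule (piPrimeSubmonoid π) (Additive M)), inferInstance,
    AddMonoidHom.toMultiplicativeRight f.toAddMonoidHom, h1, h2, fun l m hm => (h3 m hm).2 l,
    fun l m hm h => (h3 m hm).1 ?_⟩
  change l ^ m = 1 ^ m
  rw [h, one_pow]

/-- Gluing an abelian group `L` to a group `D` along an abelian subgroup `M` of `C ≤ D`, with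
`C` acting trivially on `L` and the other elements of `D` acting by inversion. -/
theorem exists_glue {D M L : Type u} [Group D] [CommGroup M] [CommGroup L] (C : Subgroup D)
    (z : M →* D) (ι : M →* L) (hι : Function.Injective ι) (hz : Function.Injective z)
    (hzC : ∀ a, z a ∈ C) (hzc : ∀ a, ∀ c ∈ C, c * z a * c⁻¹ = z a)
    (hzi : ∀ a h, h ∉ C → h * z a * h⁻¹ = (z a)⁻¹)
    (hidx : ∀ h h', h ∉ C → h' ∉ C → h * h' ∈ C) :
    ∃ (Q : Type u) (_ : Group Q) (j : D →* Q) (k : L →* Q), Function.Injective j ∧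
      Function.Injective k ∧ (∀ a, k (ι a) = j (z a)) ∧
      (∀ q, ∃ l h, q = k l * j h) ∧ (∀ l h, k l = j h → ∃ a, h = z a ∧ l = ι a) ∧
      (∀ l, ∀ h ∈ C, j h * k l = k l * j h) ∧
      (∀ l h, h ∉ C → j h * k l = (k l)⁻¹ * j h) := by
  classical
  let φ : D →* MulAut L := MonoidHom.mk' (fun h => if h ∈ C then 1 else MulEquiv.inv L) (by
    intro a b
    by_cases h1 : a ∈ C <;> by_cases h2 : b ∈ C
    · simp [h1, h2, C.mul_mem h1 h2]
    · have : a * b ∉ C := fun h => h2 ((Subgroup.mul_mem_cancel_left _ h1).1 h)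
      simp [h1, h2, this]
    · have : a * b ∉ C := fun h => h1 ((Subgroup.mul_mem_cancel_right _ h2).1 h)
      simp [h1, h2, this]
    · ext l
      simp [h1, h2, hidx a b h1 h2])
  have hφ1 : ∀ h ∈ C, ∀ l, φ h l = l := by
    intro h hh l
    change (if h ∈ C then (1 : MulAut L) else MulEquiv.inv L) l = l
    simp [hh]
  have hφ2 : ∀ h, h ∉ C → ∀ l, φ h l = l⁻¹ := by
    intro h hh l
    change (if h ∈ C then (1 : MulAut L) else MulEquiv.inv L) l = l⁻¹
    simp [hh]
  have hφ1' : ∀ h ∈ C, ∀ l, (MulEquiv.symm (φ h)) l = l := fun h hh l =>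
    (MulEquiv.symm_apply_eq _).2 (hφ1 h hh l).symm
  have hφ2' : ∀ h, h ∉ C → ∀ l, (MulEquiv.symm (φ h)) l = l⁻¹ := fun h hh l =>
    (MulEquiv.symm_apply_eq _).2 (by rw [hφ2 h hh, inv_inv])
  -- Dividing by this antidiagonal copy of `M` identifies `ι a` with `z a`. It is normal because `D`
  -- acts alike on `z a` and on `L`: trivially through `C`, by inversion otherwise.
  let ν : M →* L ⋊[φ] D := MonoidHom.mk' (fun a => ⟨(ι a)⁻¹, z a⟩) (by
    intro a b
    ext
    · simp [hφ1 _ (hzC a), mul_comm]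
    · simp)
  have hν : ∀ a, ν a = ⟨(ι a)⁻¹, z a⟩ := fun _ => rfl
  have hN : ν.range.Normal := by
    refine ⟨?_⟩
    rintro _ ⟨a, rfl⟩ g
    by_cases hg : g.right ∈ C
    · refine ⟨a, ?_⟩
      ext
      · simp [hν, hφ1 _ hg, hφ1 _ (hzC a), hφ1' _ hg, mul_comm]
      · simpa [hν] using (hzc a _ hg).symm
    · refine ⟨a⁻¹, ?_⟩
      ext
      · simp [hν, hφ2 _ hg, hφ1 _ (hzC a), hφ2' _ hg, mul_comm]
      · simpa [hν] using (hzi a _ hg).symm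
  let mk := QuotientGroup.mk' ν.range
  have hmk : ∀ x y, mk x = mk y ↔ ∃ a, x * ν a = y := by
    intro x y
    exact QuotientGroup.mk'_eq_mk' _ |>.trans (by simp)
  refine ⟨_, inferInstance, mk.comp SemidirectProduct.inr, mk.comp SemidirectProduct.inl,
    ?_, ?_, ?_, ?_, ?_, ?_, ?_⟩
  · intro h h' hh
    obtain ⟨a, ha⟩ := (hmk _ _).1 hh
    have h1 := congrArg SemidirectProduct.left ha
    have h2 := congrArg SemidirectProduct.right ha
    simp [hν] at h1 h2
    have : a = 1 := hι (by simpa using h1)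
    rw [this] at h2
    simpa using h2
  · intro l l' hh
    obtain ⟨a, ha⟩ := (hmk _ _).1 hh
    have h1 := congrArg SemidirectProduct.left ha
    have h2 := congrArg SemidirectProduct.right ha
    simp [hν] at h1 h2
    have : a = 1 := hz (by simpa using h2)
    rw [this] at h1
    simpa using h1
  · intro a
    refine (hmk _ _).2 ⟨a, ?_⟩
    ext <;> simp [hν]
  · intro q
    obtain ⟨x, rfl⟩ := QuotientGroup.mk'_surjective ν.range q
    refine ⟨x.left, x.right, ?_⟩
    rw [MonoidHom.comp_apply, MonoidHom.comp_apply, ← map_mul,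
      SemidirectProduct.inl_left_mul_inr_right]
  · intro l h hh
    obtain ⟨a, ha⟩ := (hmk _ _).1 hh
    have h1 := congrArg SemidirectProduct.left ha
    have h2 := congrArg SemidirectProduct.right ha
    simp [hν] at h1 h2
    exact ⟨a, h2.symm, by rwa [mul_inv_eq_one] at h1⟩
  · intro l h hh
    simp only [MonoidHom.comp_apply]
    rw [← map_mul, ← map_mul]
    congr 1
    ext <;> simp [hφ1 _ hh]
  · intro l h hh
    simp only [MonoidHom.comp_apply]
    rw [← map_mul, ← map_inv, ← map_inv, ← map_mul]
    congr 1
    ext <;> simp [hφ2 _ hh]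

/-- Both `c` and `g * c * g⁻¹` are `n`-th roots of the same element. -/
theorem IsUPiGroup.commute_of_pow {π : Set Nat.Primes} {D : Type u} [Group D]
    (hU : IsUPiGroup π D) {n : ℕ} (hn : IsPiPrimeNumber π n) {c g : D}
    (h : Commute g (c ^ n)) : Commute g c := by
  have h1 : (g * c * g⁻¹) ^ n = c ^ n := by
    rw [conj_pow, h.eq, mul_inv_cancel_right]
  have h2 : g * c * g⁻¹ = c := hU n hn h1
  exact mul_inv_eq_iff_eq_mul.1 h2

/-- Let `C ≤ D` be such that the elements of `D` outside `C` are involutions inverting `C`, and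
the elements of `C` without roots are central in `C`. Then `D` embeds in a group with unique
roots in which it is almost malnormal. -/
theorem exists_root_closure (π : Set Nat.Primes) {D : Type u} [Group D] (C : Subgroup D)
    (hU : IsUPiGroup π D)
    (hinv : ∀ h, h ∉ C → h * h = 1 ∧ ∀ c ∈ C, h * c * h⁻¹ = c⁻¹)
    (hidx : ∀ h h', h ∉ C → h' ∉ C → h * h' ∈ C)
    (hR : ∀ c ∈ C, (∀ c' ∈ C, Commute c' c) ∨ ∀ m, IsPiPrimeNumber π m → ∃ y ∈ C, y ^ m = c) :
    ∃ (B : Type u) (_ : Group B) (j : D →* B), Function.Injective j ∧ IsUPiGroup π B ∧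
      (∀ (b : B) m, IsPiPrimeNumber π m → ∃ y, y ^ m = b) ∧
      ∀ h h' b, h ∉ C → b⁻¹ * j h * b = j h' → b ∈ j.range := by
  -- Only the centre `Z` of `C` is localized, to `L`; by `hR`, the other elements of `C` already
  -- have their roots. The group sought is `D` glued with `L` along `Z`.
  let Z : Subgroup D := C ⊓ Subgroup.centralizer C
  have hZc : ∀ a ∈ Z, ∀ c ∈ C, Commute c a := fun a ha c hc =>
    Subgroup.mem_centralizer_iff.1 ha.2 c hc
  have hZmem : ∀ a ∈ C, (∀ c ∈ C, Commute c a) → a ∈ Z := fun a ha h =>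
    ⟨ha, Subgroup.mem_centralizer_iff.2 fun c hc => h c hc⟩
  let _ : CommGroup Z :=
    { (inferInstance : Group Z) with
      mul_comm := fun a b => Subtype.ext (hZc b b.2 a a.2.1).eq }
  obtain ⟨L, _, ι, hι, hL1, hL2, hL3⟩ := exists_commGroup_localization π Z (by
    intro m hm x hx
    have h : (x : D) ^ m = 1 ^ m := by
      rw [one_pow]
      exact congrArg Subtype.val hx
    exact Subtype.ext (hU m hm h))
  obtain ⟨Q, _, j, k, hj, hk, hjk, hQ, hjk', hcomm, hneg⟩ := exists_glue C Z.subtype ι hι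
    Z.subtype_injective (fun a => a.2.1)
    (fun a c hc => by
      have := (hZc a a.2 c hc).eq
      rw [Subgroup.coe_subtype, this, mul_inv_cancel_right])
    (fun a h hh => (hinv h hh).2 a a.2.1) hidx
  -- An element outside `C` is a nontrivial involution, so square roots are not unique and `π'`
  -- contains no even number.
  have hodd : ∀ h, h ∉ C → ∀ m, IsPiPrimeNumber π m → ¬ 2 ∣ m := by
    intro h hh m hm h2
    apply hh
    have h1 : h ^ 2 = 1 ^ 2 := by rw [pow_two, (hinv h hh).1, one_pow]
    have h3 : h = 1 := hU 2 (hm.two h2) h1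
    rw [h3]
    exact C.one_mem
  have hsq : ∀ l h, h ∉ C → (k l * j h) * (k l * j h) = 1 := by
    intro l h hh
    calc (k l * j h) * (k l * j h) = k l * (j h * k l) * j h := by group
      _ = j (h * h) := by rw [hneg l h hh, map_mul]; group
      _ = 1 := by rw [(hinv h hh).1, map_one]
  have hkj : ∀ l, ∀ c ∈ C, Commute (k l) (j c) := fun l c hc => (hcomm l c hc).symm
  have hpow : ∀ l, ∀ c ∈ C, ∀ n, (k l * j c) ^ n = k (l ^ n) * j (c ^ n) := by
    intro l c hc n
    rw [(hkj l c hc).mul_pow, map_pow, map_pow]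
  have hcen : ∀ c ∈ C, ∀ n, IsPiPrimeNumber π n → (∀ c' ∈ C, Commute c' (c ^ n)) → c ∈ Z :=
    fun c hc n hn h => hZmem c hc fun c' hc' => hU.commute_of_pow hn (h c' hc')
  -- The equation makes `c ^ n` central in `C`, hence `c` too, and then everything happens in `L`,
  -- which has no `π'`-torsion.
  have htf : ∀ l, ∀ c ∈ C, ∀ n, IsPiPrimeNumber π n → (k l * j c) ^ n = 1 → k l * j c = 1 := by
    intro l c hc n hn h
    rw [hpow l c hc] at h
    obtain ⟨a, ha, -⟩ := hjk' (l ^ n) (c ^ n)⁻¹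
      (by rw [map_inv]; exact eq_inv_of_mul_eq_one_left h)
    have hcZ : c ∈ Z := hcen c hc n hn fun c' hc' => by
      have := (hZc a a.2 c' hc').inv_right
      rw [← Subgroup.coe_subtype, ← ha, inv_inv] at this
      exact this
    have hjc : j c = k (ι ⟨c, hcZ⟩) := (hjk ⟨c, hcZ⟩).symm
    rw [map_pow j, hjc, ← map_pow, ← map_mul, ← mul_pow] at h
    have h1 := hL3 _ n hn (hk (h.trans (map_one k).symm))
    rw [hjc, ← map_mul, h1, map_one]
  have huniq : ∀ l₁ l₂, ∀ c₁ ∈ C, ∀ c₂ ∈ C, Commute c₁ c₂ → ∀ n, IsPiPrimeNumber π n →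
      (k l₁ * j c₁) ^ n = (k l₂ * j c₂) ^ n → k l₁ * j c₁ = k l₂ * j c₂ := by
    intro l₁ l₂ c₁ h₁ c₂ h₂ hc n hn h
    have hcl : Commute (k l₁) (k l₂) := by
      rw [Commute, SemiconjBy, ← map_mul, ← map_mul, mul_comm]
    have hcc : Commute (j c₁) (j c₂) := hc.map j
    have hq : Commute (k l₁ * j c₁) (k l₂ * j c₂) :=
      (hcl.mul_right (hkj l₁ c₂ h₂)).mul_left ((hkj l₂ c₁ h₁).symm.mul_right hcc)
    have e : (k l₁ * j c₁)⁻¹ * (k l₂ * j c₂) = k (l₁⁻¹ * l₂) * j (c₁⁻¹ * c₂) := by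
      rw [map_mul, map_mul, map_inv, map_inv, mul_inv_rev]
      have h3 : Commute (j c₁)⁻¹ ((k l₁)⁻¹ * k l₂) :=
        ((hkj l₁ c₁ h₁).inv_left.mul_left (hkj l₂ c₁ h₁)).symm.inv_left
      calc (j c₁)⁻¹ * (k l₁)⁻¹ * (k l₂ * j c₂) = ((j c₁)⁻¹ * ((k l₁)⁻¹ * k l₂)) * j c₂ := by group
        _ = _ := by rw [h3.eq]; group
    have h4 := htf (l₁⁻¹ * l₂) (c₁⁻¹ * c₂) (C.mul_mem (C.inv_mem h₁) h₂) n hn (by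
      rw [← e, hq.inv_left.mul_pow, inv_pow, h, inv_mul_cancel])
    rw [← e, inv_mul_eq_one] at h4
    exact h4
  refine ⟨Q, inferInstance, j, hj, ?_, ?_, ?_⟩
  · intro m hm q₁ q₂ hq
    change q₁ ^ m = q₂ ^ m at hq
    obtain ⟨l₁, h₁, rfl⟩ := hQ q₁
    obtain ⟨l₂, h₂, rfl⟩ := hQ q₂
    have hsep : ∀ l l' h c, h ∉ C → c ∈ C → (k l * j h) ^ m ≠ (k l' * j c) ^ m := by
      intro l l' h c hh hc heq
      rw [pow_eq_self_of_odd (hsq l h hh) (hodd h hh m hm), hpow l' c hc] at heq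
      obtain ⟨a, ha, -⟩ := hjk' ((l' ^ m)⁻¹ * l) (c ^ m * h⁻¹) (by
        rw [map_mul, map_mul, map_inv, map_inv, eq_mul_inv_iff_mul_eq, mul_assoc, heq,
          inv_mul_cancel_left])
      have h1 : c ^ m * h⁻¹ ∈ C := ha ▸ a.2.1
      exact hh (by simpa using C.inv_mem ((Subgroup.mul_mem_cancel_left _ (C.pow_mem hc m)).1 h1))
    by_cases hc₁ : h₁ ∈ C <;> by_cases hc₂ : h₂ ∈ C
    -- The exponent `k₁ * k₂` brings both elements into `D`, where roots are unique. The resulting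
    -- common power makes `h₁` and `h₂` commute, and `huniq` applies.
    · obtain ⟨k₁, hk₁, a₁, ha₁⟩ := hL1 l₁
      obtain ⟨k₂, hk₂, a₂, ha₂⟩ := hL1 l₂
      have e₁ : (k l₁ * j h₁) ^ (k₁ * k₂) = j (a₁ ^ k₂ * h₁ ^ (k₁ * k₂)) := by
        rw [hpow _ _ hc₁, pow_mul l₁, ha₁, ← map_pow, hjk, map_mul, Subgroup.coe_subtype,
          Subgroup.coe_pow]
      have e₂ : (k l₂ * j h₂) ^ (k₁ * k₂) = j (a₂ ^ k₁ * h₂ ^ (k₁ * k₂)) := by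
        rw [hpow _ _ hc₂, mul_comm k₁ k₂, pow_mul l₂, ha₂, ← map_pow, hjk, map_mul,
          Subgroup.coe_subtype, Subgroup.coe_pow]
      have hv : (a₁ : D) ^ k₂ * h₁ ^ (k₁ * k₂) = (a₂ : D) ^ k₁ * h₂ ^ (k₁ * k₂) := by
        apply hU m hm
        change ((a₁ : D) ^ k₂ * h₁ ^ (k₁ * k₂)) ^ m = ((a₂ : D) ^ k₁ * h₂ ^ (k₁ * k₂)) ^ m
        apply hj
        rw [map_pow, map_pow, ← e₁, ← e₂, pow_right_comm, hq, pow_right_comm]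
      have hcc : Commute h₁ h₂ := by
        apply hU.commute_of_pow (hk₁.mul hk₂)
        have h3 : Commute h₁ ((a₁ : D) ^ k₂ * h₁ ^ (k₁ * k₂)) :=
          ((hZc a₁ a₁.2 h₁ hc₁).pow_right _).mul_right (Commute.self_pow _ _)
        rw [hv] at h3
        have h4 : Commute h₁ ((a₂ : D) ^ k₁) := (hZc a₂ a₂.2 h₁ hc₁).pow_right _
        have h5 := h4.inv_right.mul_right h3
        rwa [inv_mul_cancel_left] at h5
      exact huniq l₁ l₂ h₁ hc₁ h₂ hc₂ hcc _ (hk₁.mul hk₂) (by rw [e₁, e₂, hv])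
    · exact absurd hq.symm (hsep _ _ _ _ hc₂ hc₁)
    · exact absurd hq (hsep _ _ _ _ hc₁ hc₂)
    · rwa [pow_eq_self_of_odd (hsq _ _ hc₁) (hodd _ hc₁ m hm),
        pow_eq_self_of_odd (hsq _ _ hc₂) (hodd _ hc₂ m hm)] at hq
  · intro q m hm
    obtain ⟨l, c, rfl⟩ := hQ q
    by_cases hc : c ∈ C
    swap
    · exact ⟨_, pow_eq_self_of_odd (hsq _ _ hc) (hodd _ hc m hm)⟩
    by_cases hcZ : c ∈ Z
    · obtain ⟨y, hy⟩ := hL2 (l * ι ⟨c, hcZ⟩) m hm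
      refine ⟨k y, ?_⟩
      rw [← map_pow, hy, map_mul, hjk]
      rfl
    -- For noncentral `c` no new root is needed: the `n`-th power is the noncentral element `a * c ^
    -- n` of `D`, which has an `m * n`-th root `w` in `C`; unique `n`-th roots make `j w` an `m`-th
    -- root of `k l * j c`.
    obtain ⟨n, hn, a, ha⟩ := hL1 l
    have hvC : (a : D) * c ^ n ∈ C := C.mul_mem a.2.1 (C.pow_mem hc n)
    have hstrip : ∀ g ∈ C, Commute g ((a : D) * c ^ n) → Commute g c := by
      intro g hg h
      apply hU.commute_of_pow hn
      have h5 := (hZc a a.2 g hg).inv_right.mul_right h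
      rwa [inv_mul_cancel_left] at h5
    rcases hR _ hvC with h | h
    · exact absurd (hZmem c hc fun g hg => hstrip g hg (h g hg)) hcZ
    · obtain ⟨w, hwC, hw⟩ := h (m * n) (hm.mul hn)
      have hwc : Commute w c := hstrip w hwC (by rw [← hw]; exact Commute.self_pow _ _)
      refine ⟨j w, ?_⟩
      have := huniq 1 l (w ^ m) (C.pow_mem hwC m) c hc (hwc.pow_left m) n hn (by
        rw [hpow l c hc, ha, hjk, hpow 1 _ (C.pow_mem hwC m), one_pow, map_one, one_mul,
          ← pow_mul, hw, map_mul]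
        rfl)
      rwa [map_one, one_mul, map_pow] at this
  · intro h h' b hh hb
    obtain ⟨l, g, rfl⟩ := hQ b
    have h1 : k ((l * l)⁻¹) = j (g * h' * g⁻¹ * h⁻¹) := by
      have h2 : (k l)⁻¹ * (j h * k l) = j g * j h' * (j g)⁻¹ := by
        rw [← hb]
        group
      rw [hneg l h hh] at h2
      rw [map_mul, map_mul, map_mul, map_inv, map_inv j, map_inv j, ← h2, map_mul]
      group
    obtain ⟨a, -, ha⟩ := hjk' _ _ h1
    obtain ⟨n, hn, a', ha'⟩ := hL1 l
    -- As `n` is odd, `l` is a product of powers of `l ^ n` and `l ^ 2`, which both come from `Z`.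
    obtain ⟨s, rfl⟩ : ∃ s, n = 2 * s + 1 := ⟨n / 2, by have := hodd h hh n hn; omega⟩
    have hl : l = ι (a' * a ^ s) := by
      rw [map_mul, map_pow, ← ha, ← ha', pow_succ, pow_mul, pow_two, inv_pow]
      rw [mul_comm (((l * l) ^ s)), mul_inv_cancel_right]
    refine ⟨((a' * a ^ s : Z) : D) * g, ?_⟩
    rw [map_mul, hl, hjk]
    rfl

/-! ### Elements without roots in groups of the class `𝒫_π` -/

/-- `x` has no `m`-th root for some `m ∈ π'`. -/
def LacksRoot (π : Set Nat.Primes) {G : Type u} [Group G] (x : G) : Prop :=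
  ∃ m : ℕ, IsPiPrimeNumber π m ∧ ¬ ∃ y : G, y ^ m = x

/-- Any two nontrivial elements of a group embedded in `ℤ_π` have common powers. -/
theorem exists_zpow_eq {π : Set Nat.Primes} {C : Type*} [Group C]
    (i : C →* Multiplicative (ZPi π)) (hi : Function.Injective i) (c f : C) (hf : f ≠ 1) :
    ∃ a b : ℤ, a ≠ 0 ∧ c ^ a = f ^ b := by
  let p : ℚ := (Multiplicative.toAdd (i f) : ZPi π)
  let q : ℚ := (Multiplicative.toAdd (i c) : ZPi π)
  have hp : p ≠ 0 := by
    intro h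
    apply hf
    apply hi
    rw [map_one]
    apply Multiplicative.toAdd.injective
    exact Subtype.ext h
  refine ⟨p.num * q.den, q.num * p.den, mul_ne_zero (Rat.num_ne_zero.2 hp)
    (by exact_mod_cast q.den_nz), ?_⟩
  apply hi
  apply Multiplicative.toAdd.injective
  apply Subtype.ext
  rw [map_zpow i, map_zpow i, toAdd_zpow, toAdd_zpow, AddSubgroup.coe_zsmul, AddSubgroup.coe_zsmul]
  change (p.num * q.den : ℤ) • q = (q.num * p.den : ℤ) • p
  rw [zsmul_eq_mul, zsmul_eq_mul]
  push_cast
  have h1 : q * q.den = q.num := Rat.mul_den_eq_num q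
  have h2 : p * p.den = p.num := Rat.mul_den_eq_num p
  linear_combination (p.num : ℚ) * h1 - (q.num : ℚ) * h2

theorem eq_of_zpow_eq_of_embeds {π : Set Nat.Primes} {C : Type*} [Group C]
    (i : C →* Multiplicative (ZPi π)) (hi : Function.Injective i) {c f : C} {a : ℤ} (ha : a ≠ 0)
    (h : c ^ a = f ^ a) : c = f := by
  apply hi
  apply Multiplicative.toAdd.injective
  apply Subtype.ext
  have h1 := congrArg (fun z : C => ((Multiplicative.toAdd (i z) : ZPi π) : ℚ)) h
  simp only [map_zpow, toAdd_zpow, AddSubgroup.coe_zsmul, zsmul_eq_mul] at h1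
  exact mul_left_cancel₀ (by exact_mod_cast ha) h1

namespace InClassPPi

variable {π : Set Nat.Primes} {G : Type u} [Group G]

theorem ne_one_of_lacksRoot {x : G} (hx : LacksRoot π x) : x ≠ 1 := by
  rintro rfl
  obtain ⟨m, -, hm⟩ := hx
  exact hm ⟨1, one_pow m⟩

/-- In case (b), `f = c * (h * c * h⁻¹)` is fixed by `h`, as `h * h` lies in the abelian group `C`.
If `f ≠ 1`, a nonzero power of `x` is a power of `f`, so `h` commutes with it and hence with `x`.
Thus `h` inverts `C`; it both fixes and inverts `h * h`, which is trivial because `C` is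
torsion-free. -/
theorem exists_subgroup (hG : InClassPPi π G) {x : G} (hx : LacksRoot π x) :
    ∃ D : Subgroup G, (D : Set G) = DSet x ∧ elemCentralizer x ≤ D ∧
      (∀ h ∈ D, h ∉ elemCentralizer x →
        h * h = 1 ∧ ∀ c ∈ elemCentralizer x, h * c * h⁻¹ = c⁻¹) := by
  have hcond := hG.cond x hx
  set C := elemCentralizer x with hC
  obtain ⟨htf, h | ⟨⟨D, hD, hidx⟩, i, hi⟩⟩ := hcond
  · exact ⟨C, h.symm, le_rfl, fun h h1 h2 => absurd h1 h2⟩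
  have hx1 : x ≠ 1 := ne_one_of_lacksRoot hx
  have hxC : x ∈ C := mem_elemCentralizer.2 rfl
  have hCD : C ≤ D := by
    intro g hg
    change g ∈ (D : Set G)
    rw [hD, mem_DSet]
    refine ⟨x, hx1, hxC, ?_⟩
    rwa [mem_elemCentralizer.1 hg, mul_inv_cancel_right]
  have hcomm : ∀ a ∈ C, ∀ b ∈ C, a * b = b * a := by
    intro a ha b hb
    have : (⟨a, ha⟩ : C) * ⟨b, hb⟩ = ⟨b, hb⟩ * ⟨a, ha⟩ := by
      apply hi
      rw [map_mul, map_mul, mul_comm]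
    exact congrArg Subtype.val this
  have hnorm : (C.subgroupOf D).Normal := Subgroup.normal_of_index_eq_two hidx
  have hconj : ∀ h ∈ D, ∀ c ∈ C, h * c * h⁻¹ ∈ C := by
    intro h hh c hc
    have := hnorm.conj_mem ⟨c, hCD hc⟩ (Subgroup.mem_subgroupOf.2 hc) ⟨h, hh⟩
    simpa [Subgroup.mem_subgroupOf] using this
  refine ⟨D, hD, hCD, fun h hh hhC => ?_⟩
  have hsq : h * h ∈ C := by
    have := (Subgroup.mul_mem_iff_of_index_two hidx (a := ⟨h, hh⟩) (b := ⟨h, hh⟩)).2 Iff.rfl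
    simpa [Subgroup.mem_subgroupOf] using this
  have hinv : ∀ c ∈ C, h * c * h⁻¹ = c⁻¹ := by
    intro c hc
    by_contra hne
    have hfC : c * (h * c * h⁻¹) ∈ C := C.mul_mem hc (hconj h hh c hc)
    set f := c * (h * c * h⁻¹) with hf
    have hf1 : f ≠ 1 := fun h1 => hne (eq_inv_of_mul_eq_one_right h1)
    have hfix : h * f * h⁻¹ = f := by
      calc h * f * h⁻¹ = (h * c * h⁻¹) * ((h * h) * c * (h * h)⁻¹) := by rw [hf]; group
        _ = (h * c * h⁻¹) * c := by rw [hcomm _ hsq c hc, mul_inv_cancel_right]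
        _ = f := hcomm _ (hconj h hh c hc) _ hc
    obtain ⟨a, b, ha, hab⟩ := exists_zpow_eq i hi ⟨x, hxC⟩ ⟨f, hfC⟩
      (fun h1 => hf1 (congrArg Subtype.val h1))
    have hab' : x ^ a = f ^ b := congrArg Subtype.val hab
    have hxa : (h * x * h⁻¹) ^ a = x ^ a := by
      rw [conj_zpow, hab', ← conj_zpow, hfix]
    have := eq_of_zpow_eq_of_embeds i hi (c := ⟨h * x * h⁻¹, hconj h hh x hxC⟩)
      (f := ⟨x, hxC⟩) ha (Subtype.ext hxa)
    have hx' : h * x * h⁻¹ = x := congrArg Subtype.val this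
    exact hhC (mem_elemCentralizer.2 (mul_inv_eq_iff_eq_mul.1 hx'))
  refine ⟨?_, hinv⟩
  apply htf _ hsq
  rw [isOfFinOrder_iff_pow_eq_one]
  refine ⟨2, by norm_num, ?_⟩
  have h1 := hinv _ hsq
  rw [pow_two]
  calc h * h * (h * h) = (h * (h * h) * h⁻¹) * (h * h) := by group
    _ = 1 := by rw [h1, inv_mul_cancel]

theorem sq_ne_one (hG : InClassPPi π G) {x : G} (hx : LacksRoot π x) {c : G}
    (hc : c ∈ elemCentralizer x) (hc1 : c ≠ 1) : c * c ≠ 1 := by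
  intro h
  apply hc1
  apply (hG.cond x hx).1 c hc
  rw [isOfFinOrder_iff_pow_eq_one]
  exact ⟨2, by norm_num, by rw [pow_two, h]⟩

/-- Such a `g` lies in `D_G(x)`; outside `C_G(x)` it would invert `c` as well, forcing `c * c = 1`.
-/
theorem mem_of_commute (hG : InClassPPi π G) {x : G} (hx : LacksRoot π x) {c g : G}
    (hc : c ∈ elemCentralizer x) (hc1 : c ≠ 1) (hg : g * c = c * g) :
    g ∈ elemCentralizer x := by
  obtain ⟨D, hD, -, hinv⟩ := hG.exists_subgroup hx
  have hgc : g * c * g⁻¹ = c := by rw [hg, mul_inv_cancel_right]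
  have hgD : g ∈ D := by
    change g ∈ (D : Set G)
    rw [hD, mem_DSet]
    exact ⟨c, hc1, hc, by rwa [hgc]⟩
  by_contra h
  have h1 := (hinv g hgD h).2 c hc
  rw [hgc] at h1
  apply hG.sq_ne_one hx hc hc1
  nth_rewrite 1 [h1]
  exact inv_mul_cancel c

theorem elemCentralizer_eq (hG : InClassPPi π G) {x y c : G} (hx : LacksRoot π x)
    (hy : LacksRoot π y) (hcx : c ∈ elemCentralizer x) (hcy : c ∈ elemCentralizer y)
    (hc1 : c ≠ 1) : elemCentralizer x = elemCentralizer y := by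
  have h1 : y ∈ elemCentralizer x :=
    hG.mem_of_commute hx hcx hc1 (mem_elemCentralizer.1 hcy).symm
  have h2 : x ∈ elemCentralizer y := mem_elemCentralizer.2 (mem_elemCentralizer.1 h1).symm
  apply le_antisymm
  · intro g hg
    exact hG.mem_of_commute hy h2 (ne_one_of_lacksRoot hx) (mem_elemCentralizer.1 hg)
  · intro g hg
    exact hG.mem_of_commute hx h1 (ne_one_of_lacksRoot hy) (mem_elemCentralizer.1 hg)

/-- A nontrivial `c` lacking roots has the same centralizer as `x`. Otherwise its roots commute with
it and so stay in `C_G(x)`. -/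
theorem central_or_roots (hG : InClassPPi π G) {x : G} (hx : LacksRoot π x) {c : G}
    (hc : c ∈ elemCentralizer x) :
    (∀ c' ∈ elemCentralizer x, Commute c' c) ∨
      ∀ m, IsPiPrimeNumber π m → ∃ y ∈ elemCentralizer x, y ^ m = c := by
  by_cases hc1 : c = 1
  · left
    rintro c' -
    rw [hc1]
    exact Commute.one_right c'
  by_cases hbad : LacksRoot π c
  · left
    intro c' hc'
    rw [hG.elemCentralizer_eq hx hbad hc (mem_elemCentralizer.2 rfl) hc1] at hc'
    exact mem_elemCentralizer.1 hc'
  · right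
    intro m hm
    unfold LacksRoot at hbad
    push Not at hbad
    obtain ⟨y, rfl⟩ := hbad m hm
    exact ⟨y, hG.mem_of_commute hx hc hc1 (Commute.self_pow y m).eq, rfl⟩

theorem lacksRoot_conj {x : G} (hx : LacksRoot π x) (g : G) : LacksRoot π (g * x * g⁻¹) := by
  obtain ⟨m, hm, h⟩ := hx
  refine ⟨m, hm, ?_⟩
  rintro ⟨y, hy⟩
  refine h ⟨g⁻¹ * y * g, ?_⟩
  have := conj_pow (i := m) (a := g⁻¹) (b := y)
  rw [inv_inv] at this
  rw [this, hy]
  group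

theorem mem_elemCentralizer_conj {x g h : G} :
    h ∈ elemCentralizer (g * x * g⁻¹) ↔ g⁻¹ * h * g ∈ elemCentralizer x := by
  rw [mem_elemCentralizer, mem_elemCentralizer]
  constructor <;> intro e
  · have := congrArg (fun z => g⁻¹ * z * g) e
    simpa [mul_assoc] using this
  · have := congrArg (fun z => g * z * g⁻¹) e
    simpa [mul_assoc] using this

/-- The elements lacking roots, up to conjugacy of their centralizers. -/
def centralizerSetoid (π : Set Nat.Primes) (G : Type u) [Group G] :
    Setoid {x : G // LacksRoot π x} where
  r x y := ∃ g : G, ∀ h, h ∈ elemCentralizer (x : G) ↔ g * h * g⁻¹ ∈ elemCentralizer (y : G)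
  iseqv :=
    { refl := fun x => ⟨1, fun h => by simp⟩
      symm := by
        rintro x y ⟨g, hg⟩
        refine ⟨g⁻¹, fun h => ?_⟩
        rw [hg]
        simp [mul_assoc]
      trans := by
        rintro x y z ⟨g, hg⟩ ⟨k, hk⟩
        refine ⟨k * g, fun h => ?_⟩
        rw [hg, hk]
        simp [mul_assoc] }

/-- A group in `𝒫_π` embeds in a group in `𝒫_π` in which all its elements have roots. -/
theorem exists_root_extension (hG : InClassPPi π G) :
    ∃ (Γ : Type u) (_ : Group Γ) (φ : G →* Γ), Function.Injective φ ∧ InClassPPi π Γ ∧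
      ∀ (g : G) m, IsPiPrimeNumber π m → ∃ y, y ^ m = φ g := by
  let I := Quotient (centralizerSetoid π G)
  let x : I → G := fun i => i.out.1
  have hx : ∀ i, LacksRoot π (x i) := fun i => i.out.2
  choose D hD hCD hinv using fun i => hG.exists_subgroup (hx i)
  have hB : ∀ i, ∃ (B : Type u) (_ : Group B) (j : D i →* B), Function.Injective j ∧
      IsUPiGroup π B ∧ (∀ (b : B) m, IsPiPrimeNumber π m → ∃ y, y ^ m = b) ∧
      ∀ h h' b, h ∉ (elemCentralizer (x i)).subgroupOf (D i) → b⁻¹ * j h * b = j h' →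
        b ∈ j.range := by
    intro i
    have hinvi : ∀ h : D i, h ∉ (elemCentralizer (x i)).subgroupOf (D i) →
        h * h = 1 ∧ ∀ c ∈ (elemCentralizer (x i)).subgroupOf (D i), h * c * h⁻¹ = c⁻¹ := by
      intro h hh
      rw [Subgroup.mem_subgroupOf] at hh
      obtain ⟨h1, h2⟩ := hinv i h h.2 hh
      exact ⟨Subtype.ext h1, fun c hc => Subtype.ext (h2 c hc)⟩
    refine exists_root_closure π ((elemCentralizer (x i)).subgroupOf (D i)) ?_ hinvi ?_ ?_
    · intro m hm a b hab
      exact Subtype.ext (hG.isUPiGroup m hm (congrArg Subtype.val hab))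
    · intro h h' hh hh'
      rw [Subgroup.mem_subgroupOf] at hh hh' ⊢
      have hxC : x i ∈ elemCentralizer (x i) := mem_elemCentralizer.2 rfl
      have h1 := (hinv i h h.2 hh).2 _ ((elemCentralizer (x i)).inv_mem hxC)
      have h2 := (hinv i h' h'.2 hh').2 _ hxC
      rw [mem_elemCentralizer, ← mul_inv_eq_iff_eq_mul]
      calc ((h * h' : D i) : G) * x i * ((h * h' : D i) : G)⁻¹
          = h * (h' * x i * (h' : G)⁻¹) * (h : G)⁻¹ := by rw [Subgroup.coe_mul]; group
        _ = x i := by rw [h2, h1, inv_inv]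
    · intro c hc
      rw [Subgroup.mem_subgroupOf] at hc
      rcases hG.central_or_roots (hx i) hc with h | h
      · exact Or.inl fun c' hc' => Subtype.ext (h c' hc').eq
      · refine Or.inr fun m hm => ?_
        obtain ⟨y, hy, hym⟩ := h m hm
        exact ⟨⟨y, hCD i hy⟩, hy, Subtype.ext hym⟩
  choose B instB j hj hUB hRB hDB using hB
  -- `B i` contains a root of `x i` that `G` lacks.
  have hj' : ∀ i, ∃ b, b ∉ (j i).range := by
    intro i
    have hxC : x i ∈ D i := hCD i (mem_elemCentralizer.2 rfl)
    obtain ⟨m, hm, hno⟩ := hx i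
    obtain ⟨y, hy⟩ := hRB i (j i ⟨x i, hxC⟩) m hm
    refine ⟨y, ?_⟩
    rintro ⟨d, rfl⟩
    rw [← map_pow] at hy
    exact hno ⟨d, congrArg Subtype.val (hj i hy)⟩
  obtain ⟨A⟩ := Amalgam.nonempty D j hj hj'
  have hRG : ∀ (g : G) m, IsPiPrimeNumber π m → ∃ y, y ^ m = A.φ g := by
    intro g m hm
    by_cases hg : LacksRoot π g
    · let i : I := Quotient.mk (centralizerSetoid π G) ⟨g, hg⟩
      obtain ⟨a, ha⟩ : ∃ a : G, ∀ h, h ∈ elemCentralizer (x i) ↔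
          a * h * a⁻¹ ∈ elemCentralizer g := Quotient.exact (Quotient.out_eq i)
      have h1 : a⁻¹ * g * a ∈ D i := hCD i ((ha _).2 (by
        rw [show a * (a⁻¹ * g * a) * a⁻¹ = g by group]
        exact mem_elemCentralizer.2 rfl))
      obtain ⟨y, hy⟩ := hRB i (j i ⟨_, h1⟩) m hm
      refine ⟨A.φ a * A.ψ i y * (A.φ a)⁻¹, ?_⟩
      rw [conj_pow, ← map_pow, hy, A.compat, ← map_inv, ← map_mul, ← map_mul]
      congr 1
      change a * (a⁻¹ * g * a) * a⁻¹ = g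
      group
    · unfold LacksRoot at hg
      push Not at hg
      obtain ⟨y, rfl⟩ := hg m hm
      exact ⟨A.φ y, (map_pow _ _ _).symm⟩
  refine ⟨A.Γ, inferInstance, A.φ, A.φ_injective, ?_, hRG⟩
  refine A.inClassPPi (fun i => elemCentralizer (x i)) hG.isUPiGroup hUB hRG hRB ?_
    (fun i h hh hhC => (hinv i h hh hhC).1) (fun i h h' b hh hb => hDB i h h' b hh hb)
  -- The conjugate of `c` is no involution, so it lies in `C_G(x i')`. Then `C_G(x i)` is conjugate
  -- to `C_G(x i')`, and `i = i'` since one representative was taken per class.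
  intro i i' g c hc hc1 hgc
  have hgc' : g⁻¹ * c * g ∈ elemCentralizer (x i') := by
    by_contra hno
    have h1 := (hinv i' _ hgc hno).1
    apply hG.sq_ne_one (hx i) hc hc1
    have h2 := congrArg (fun z => g * z * g⁻¹) h1
    simpa [mul_assoc] using h2
  have heq := hG.elemCentralizer_eq (hx i) (lacksRoot_conj (hx i') g) hc
    (mem_elemCentralizer_conj.2 hgc') hc1
  obtain rfl : i = i' := by
    rw [← Quotient.out_eq i, ← Quotient.out_eq i']
    apply Quotient.sound
    refine ⟨g⁻¹, fun h => ?_⟩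
    change h ∈ elemCentralizer (x i) ↔ _
    rw [heq, mem_elemCentralizer_conj, inv_inv]
  refine ⟨rfl, ?_⟩
  change g ∈ (D i : Set G)
  rw [hD, mem_DSet]
  refine ⟨g⁻¹ * c * g, ?_, hgc', ?_⟩
  · intro h
    apply hc1
    have h2 := congrArg (fun z => g * z * g⁻¹) h
    simpa [mul_assoc] using h2
  · rwa [show g * (g⁻¹ * c * g) * g⁻¹ = c by group]

end InClassPPi

/-! ### The limit of a chain of root extensions -/

theorem isPiPrimeNumber_of_notMem {π : Set Nat.Primes} {q : Nat.Primes} (hq : q ∉ π) :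
    IsPiPrimeNumber π q := by
  refine ⟨q.2.pos, fun p hp => ?_⟩
  rwa [show p = q from Subtype.ext ((Nat.prime_dvd_prime_iff_eq p.2 q.2).1 hp)]

section Chain

variable {H : ℕ → Type u} [∀ n, Group (H n)] (f : ∀ n, H n →* H (n + 1))

/-- The eventually coherent sequences of a chain of groups. -/
def coherent : Subgroup (∀ n, H n) where
  carrier := {a | ∃ N, ∀ n ≥ N, a (n + 1) = f n (a n)}
  one_mem' := ⟨0, fun n _ => by simp⟩
  mul_mem' := by
    rintro a b ⟨N, hN⟩ ⟨M, hM⟩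
    refine ⟨max N M, fun n hn => ?_⟩
    simp [hN n (le_of_max_le_left hn), hM n (le_of_max_le_right hn)]
  inv_mem' := by
    rintro a ⟨N, hN⟩
    exact ⟨N, fun n hn => by simp [hN n hn]⟩

/-- The sequences that are eventually trivial. -/
def eventuallyOne : Subgroup (coherent f) where
  carrier := {a | ∃ N, ∀ n ≥ N, (a : ∀ n, H n) n = 1}
  one_mem' := ⟨0, fun n _ => rfl⟩
  mul_mem' := by
    rintro a b ⟨N, hN⟩ ⟨M, hM⟩
    refine ⟨max N M, fun n hn => ?_⟩
    simp [hN n (le_of_max_le_left hn), hM n (le_of_max_le_right hn)]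
  inv_mem' := by
    rintro a ⟨N, hN⟩
    exact ⟨N, fun n hn => by simp [hN n hn]⟩

theorem mem_eventuallyOne {a : coherent f} :
    a ∈ eventuallyOne f ↔ ∃ N, ∀ n ≥ N, (a : ∀ n, H n) n = 1 := Iff.rfl

instance eventuallyOne_normal : (eventuallyOne f).Normal := by
  refine ⟨?_⟩
  rintro a ⟨N, hN⟩ g
  exact ⟨N, fun n hn => by simp [hN n hn]⟩

/-- The limit of a chain of groups. -/
abbrev ChainLimit := coherent f ⧸ eventuallyOne f

/-- The coherent sequence of the images of an element of the first group. -/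
def orbitSeq (g : H 0) : ∀ n, H n
  | 0 => g
  | n + 1 => f n (orbitSeq g n)

theorem orbitSeq_mul (g h : H 0) : orbitSeq f (g * h) = orbitSeq f g * orbitSeq f h := by
  ext n
  induction n with
  | zero => rfl
  | succ n ih =>
    change f n (orbitSeq f (g * h) n) = f n (orbitSeq f g n) * f n (orbitSeq f h n)
    rw [ih, Pi.mul_apply, map_mul]

/-- The map from the first group to the limit. -/
def toChainLimit : H 0 →* ChainLimit f :=
  (QuotientGroup.mk' (eventuallyOne f)).comp
    (MonoidHom.mk' (fun g => (⟨orbitSeq f g, 0, fun _ _ => rfl⟩ : coherent f))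
      fun a b => Subtype.ext (orbitSeq_mul f a b))

theorem toChainLimit_injective (hf : ∀ n, Function.Injective (f n)) :
    Function.Injective (toChainLimit f) := by
  rw [injective_iff_map_eq_one]
  intro g hg
  obtain ⟨N, hN⟩ := (QuotientGroup.eq_one_iff _).1 hg
  have h1 : orbitSeq f g N = 1 := hN N le_rfl
  clear hN
  induction N with
  | zero => exact h1
  | succ n ih => exact ih (hf n (by rw [map_one]; exact h1))

/-- Roots of the `n`-th term are found one stage later, and their uniqueness makes the shifted
sequence of roots coherent. -/
theorem chainLimit_isPiLocal {π : Set Nat.Primes} (hU : ∀ n, IsUPiGroup π (H n))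
    (hR : ∀ n (a : H n) m, IsPiPrimeNumber π m → ∃ y, y ^ m = f n a) :
    IsPiLocal π (ChainLimit f) := by
  intro q hq
  have hqm := isPiPrimeNumber_of_notMem hq
  constructor
  · intro a b hab
    obtain ⟨a, rfl⟩ := QuotientGroup.mk_surjective a
    obtain ⟨b, rfl⟩ := QuotientGroup.mk_surjective b
    have hab : ((a ^ (q : ℕ) : coherent f) : ChainLimit f) = (b ^ (q : ℕ) : coherent f) := hab
    rw [QuotientGroup.eq, mem_eventuallyOne] at hab
    obtain ⟨N, hN⟩ := hab
    rw [QuotientGroup.eq]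
    refine ⟨N, fun n hn => ?_⟩
    have h1 := hN n hn
    simp only [Subgroup.coe_mul, Subgroup.coe_inv, Subgroup.coe_pow, Pi.mul_apply, Pi.inv_apply,
      Pi.pow_apply, inv_mul_eq_one] at h1 ⊢
    exact hU n q hqm h1
  · intro a
    obtain ⟨⟨a, N, hN⟩, rfl⟩ := QuotientGroup.mk_surjective a
    choose r hr using fun n => hR n (a n) q hqm
    -- The value at `0` is arbitrary, as only the tail of a sequence matters in the limit.
    let b : ∀ n, H n := fun n => match n with
      | 0 => 1
      | n + 1 => r n
    have hb : ∀ n, b (n + 1) = r n := fun _ => rfl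
    have hbN : b ∈ coherent f := by
      refine ⟨N + 1, fun n hn => ?_⟩
      obtain ⟨k, rfl⟩ : ∃ k, n = k + 1 := ⟨n - 1, by omega⟩
      apply hU _ q hqm
      change b (k + 1 + 1) ^ (q : ℕ) = f (k + 1) (b (k + 1)) ^ (q : ℕ)
      rw [← map_pow, hb, hb, hr, hr, hN k (by omega)]
    refine ⟨((⟨b, hbN⟩ : coherent f) : ChainLimit f), ?_⟩
    change (((⟨b, hbN⟩ : coherent f) ^ (q : ℕ) : coherent f) : ChainLimit f) = _
    rw [QuotientGroup.eq]
    refine ⟨N + 1, fun n hn => ?_⟩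
    obtain ⟨k, rfl⟩ : ∃ k, n = k + 1 := ⟨n - 1, by omega⟩
    simp only [Subgroup.coe_mul, Subgroup.coe_inv, Subgroup.coe_pow, Pi.mul_apply, Pi.inv_apply,
      Pi.pow_apply, inv_mul_eq_one]
    rw [hb, hr, hN k (by omega)]

end Chain

/-- A group in the class `𝒫_π`, bundled. -/
structure PPiGroup (π : Set Nat.Primes) where
  /-- the underlying type -/
  carrier : Type u
  [grp : Group carrier]
  mem : InClassPPi π carrier

attribute [instance] PPiGroup.grp

/-- The iterates of a construction on groups in `𝒫_π`. -/
def PPiGroup.iterate {π : Set Nat.Primes} (next : PPiGroup.{u} π → PPiGroup.{u} π)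
    (K : PPiGroup.{u} π) : ℕ → PPiGroup.{u} π
  | 0 => K
  | n + 1 => next (PPiGroup.iterate next K n)

/-- A group in `𝒫_π` embeds in a `π`-local group. -/
theorem InClassPPi.exists_embedding {π : Set Nat.Primes} {G : Type u} [Group G]
    (hG : InClassPPi π G) :
    ∃ (H : Type u) (_ : Group H) (θ : G →* H), IsPiLocal π H ∧ Function.Injective θ := by
  have step : ∀ K : PPiGroup.{u} π, ∃ (K' : PPiGroup.{u} π) (φ : K.carrier →* K'.carrier),
      Function.Injective φ ∧ ∀ (g : K.carrier) m, IsPiPrimeNumber π m → ∃ y, y ^ m = φ g := by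
    intro K
    obtain ⟨Γ, _, φ, h1, h2, h3⟩ := K.mem.exists_root_extension
    exact ⟨⟨Γ, h2⟩, φ, h1, h3⟩
  choose next φ hφ hroot using step
  let K := PPiGroup.iterate next ⟨G, hG⟩
  let f : ∀ n : ℕ, (K n).carrier →* (K (n + 1)).carrier := fun n => φ (K n)
  exact ⟨ChainLimit f, inferInstance, toChainLimit f,
    chainLimit_isPiLocal f (fun n => (K n).mem.isUPiGroup) (fun n => hroot (K n)),
    toChainLimit_injective f fun n => hφ (K n)⟩

/-! ### Existence of localizations -/

/-- Formal expressions in the elements of `G`, built with products, inverses and roots. -/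
inductive RootTerm (G : Type u) : Type u
  | of : G → RootTerm G
  | mul : RootTerm G → RootTerm G → RootTerm G
  | inv : RootTerm G → RootTerm G
  | root : Nat.Primes → RootTerm G → RootTerm G

namespace RootTerm

variable {π : Set Nat.Primes} {G : Type u} [Group G]

open Classical in
/-- The value of an expression in a `π`-local group; roots of orders in `π` are ignored. -/
noncomputable def eval {H : Type u} [Group H] (hH : IsPiLocal π H) (θ : G →* H) :
    RootTerm G → H
  | of g => θ g
  | mul s t => eval hH θ s * eval hH θ t
  | inv t => (eval hH θ t)⁻¹
  | root q t => if hq : q ∉ π then ((hH q hq).2 (eval hH θ t)).choose else 1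

theorem eval_root {H : Type u} [Group H] (hH : IsPiLocal π H) (θ : G →* H) {q : Nat.Primes}
    (hq : q ∉ π) (t : RootTerm G) : eval hH θ (root q t) ^ (q : ℕ) = eval hH θ t := by
  rw [eval, dif_pos hq]
  exact ((hH q hq).2 (eval hH θ t)).choose_spec

theorem eval_root_of_mem {H : Type u} [Group H] (hH : IsPiLocal π H) (θ : G →* H)
    {q : Nat.Primes} (hq : q ∈ π) (t : RootTerm G) : eval hH θ (root q t) = 1 := by
  rw [eval, dif_neg (not_not.2 hq)]

variable (π G) in
/-- Two expressions are equivalent if they have the same values in all `π`-local groups. -/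
def setoid : Setoid (RootTerm G) where
  r s t := ∀ (H : Type u) [Group H] (hH : IsPiLocal π H) (θ : G →* H), eval hH θ s = eval hH θ t
  iseqv :=
    { refl := fun _ _ _ _ _ => rfl
      symm := fun h H _ hH θ => (h H hH θ).symm
      trans := fun h h' H _ hH θ => (h H hH θ).trans (h' H hH θ) }

end RootTerm

/-- The `π`-localization of a group. -/
def PiLocalization (π : Set Nat.Primes) (G : Type u) [Group G] : Type u :=
  Quotient (RootTerm.setoid π G)

namespace PiLocalization

open RootTerm

variable {π : Set Nat.Primes} {G : Type u} [Group G]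

/-- The class of an expression. -/
def mk (t : RootTerm G) : PiLocalization π G := Quotient.mk _ t

theorem mk_eq {s t : RootTerm G} : (mk s : PiLocalization π G) = mk t ↔
    ∀ (H : Type u) [Group H] (hH : IsPiLocal π H) (θ : G →* H), eval hH θ s = eval hH θ t :=
  ⟨fun h => Quotient.exact h, fun h => Quotient.sound h⟩

theorem mk_surjective (a : PiLocalization π G) : ∃ t, mk t = a := Quotient.exists_rep a

instance : Mul (PiLocalization π G) :=
  ⟨Quotient.map₂ RootTerm.mul fun s s' hs t t' ht H _ hH θ => by
    simp only [eval, hs H hH θ, ht H hH θ]⟩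

instance : Inv (PiLocalization π G) :=
  ⟨Quotient.map RootTerm.inv fun s s' hs H _ hH θ => by simp only [eval, hs H hH θ]⟩

instance : One (PiLocalization π G) := ⟨mk (of 1)⟩

theorem mk_mul (s t : RootTerm G) : (mk s * mk t : PiLocalization π G) = mk (mul s t) := rfl

theorem mk_inv (t : RootTerm G) : ((mk t)⁻¹ : PiLocalization π G) = mk (inv t) := rfl

instance : Group (PiLocalization π G) :=
  Group.ofLeftAxioms
    (by
      intro a b c
      obtain ⟨r, rfl⟩ := mk_surjective a
      obtain ⟨s, rfl⟩ := mk_surjective b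
      obtain ⟨t, rfl⟩ := mk_surjective c
      exact mk_eq.2 fun H _ hH θ => by simp only [eval, mul_assoc])
    (by
      intro a
      obtain ⟨r, rfl⟩ := mk_surjective a
      exact mk_eq.2 fun H _ hH θ => by simp only [eval, map_one, one_mul])
    (by
      intro a
      obtain ⟨r, rfl⟩ := mk_surjective a
      exact mk_eq.2 fun H _ hH θ => by simp only [eval, map_one, inv_mul_cancel])

/-- The homomorphism from a group to its localization. -/
def of : G →* PiLocalization π G :=
  MonoidHom.mk' (fun g => mk (RootTerm.of g)) fun a b =>
    mk_eq.2 fun H _ hH θ => by simp only [eval, map_mul]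

/-- The homomorphism induced by a homomorphism to a `π`-local group. -/
noncomputable def lift {H : Type u} [Group H] (hH : IsPiLocal π H) (θ : G →* H) :
    PiLocalization π G →* H :=
  MonoidHom.mk' (Quotient.lift (eval hH θ) fun _ _ h => h H hH θ) (by
    intro a b
    obtain ⟨s, rfl⟩ := mk_surjective a
    obtain ⟨t, rfl⟩ := mk_surjective b
    rfl)

theorem lift_mk {H : Type u} [Group H] (hH : IsPiLocal π H) (θ : G →* H) (t : RootTerm G) :
    lift hH θ (mk t) = eval hH θ t := rfl

theorem eq_of_lift {a b : PiLocalization π G}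
    (h : ∀ (H : Type u) [Group H] (hH : IsPiLocal π H) (θ : G →* H),
      lift hH θ a = lift hH θ b) : a = b := by
  obtain ⟨s, rfl⟩ := mk_surjective a
  obtain ⟨t, rfl⟩ := mk_surjective b
  exact mk_eq.2 h

/-- The lifts to `π`-local groups jointly separate points, so both uniqueness and the defining
equation of a root can be checked after lifting. -/
theorem isPiLocal : IsPiLocal π (PiLocalization π G) := by
  intro q hq
  constructor
  · intro a b hab
    apply eq_of_lift
    intro H _ hH θ
    apply (hH q hq).1
    change lift hH θ a ^ (q : ℕ) = lift hH θ b ^ (q : ℕ)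
    rw [← map_pow, ← map_pow]
    exact congrArg _ hab
  · intro a
    obtain ⟨t, rfl⟩ := mk_surjective a
    refine ⟨mk (root q t), ?_⟩
    apply eq_of_lift
    intro H _ hH θ
    change lift hH θ (mk (root q t) ^ (q : ℕ)) = _
    rw [map_pow, lift_mk, lift_mk, eval_root hH θ hq]

/-- Uniqueness is by induction on expressions: values at roots are forced by injectivity of the
`q`-th power in `H`, and for `q ∈ π` the root expression is the identity by convention. -/
theorem isPiLocalization : IsPiLocalization π (of : G →* PiLocalization π G) where
  isPiLocal := isPiLocal
  existsUnique_lift H _ hH θ := by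
    refine ⟨lift hH θ, MonoidHom.ext fun g => rfl, ?_⟩
    intro θ' h
    ext a
    obtain ⟨t, rfl⟩ := mk_surjective a
    rw [lift_mk]
    induction t with
    | of g => exact DFunLike.congr_fun h g
    | mul s t hs ht => rw [← mk_mul, map_mul, hs, ht, eval]
    | inv t ht => rw [← mk_inv, map_inv, ht, eval]
    | root q t ht =>
      by_cases hq : q ∈ π
      · have h1 : (mk (root q t) : PiLocalization π G) = 1 :=
          mk_eq.2 fun H _ hH θ => by rw [eval_root_of_mem hH θ hq, eval, map_one]
        rw [h1, map_one, eval_root_of_mem hH θ hq]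
      · apply (hH q hq).1
        change θ' (mk (root q t)) ^ (q : ℕ) = eval hH θ (root q t) ^ (q : ℕ)
        rw [eval_root hH θ hq, ← ht, ← map_pow]
        congr 1
        apply eq_of_lift
        intro H _ hH θ
        rw [map_pow, lift_mk, lift_mk, eval_root hH θ hq]

end PiLocalization

theorem theorem2p5 (π : Set Nat.Primes) (G : Type u) [Group G] (hG : InClassPPi π G) :
    (∃ (L : Type u) (_ : Group L) (φ : G →* L), IsPiLocalization π φ) ∧
    (∀ (L : Type u) [Group L] (φ : G →* L), IsPiLocalization π φ → Function.Injective φ) := by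
  refine ⟨⟨PiLocalization π G, inferInstance, PiLocalization.of,
    PiLocalization.isPiLocalization⟩, ?_⟩
  intro L _ φ hφ
  obtain ⟨H, _, θ, hH, hθ⟩ := hG.exists_embedding
  obtain ⟨θ', h, -⟩ := hφ.existsUnique_lift H hH θ
  rw [← h, MonoidHom.coe_comp] at hθ
  exact hθ.of_comp
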